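/- Fix a bijection $\nu:\mathbb N\to\mathbb Q$ with $\nu(0)=0$. A sequence $w\in\mathbb N^{\mathbb N}$ is a $\rho$-name of $x\in\mathbb R$, written $\rho(w)=x$, if $|\nu(w(i))-x|\le 2^{-i}$ for all $i\in\mathbb N$. A multivalued function is identified with the set of its choice functions, which share one domain. For multivalued functions $A,B$ between topological spaces, $A\le_2 B$ means that there are continuous partial functions $F,G$ such that $w\mapsto F(w,g(G(w)))$ belongs to $A$ for each $g\in B$. For $z\ge 1$, $\langle P\rangle^z$ is the set of all functions $(x_1,\dots,x_z)\mapsto(f_1(x_1),\dots,f_z(x_z))$ with $f_1,\dots,f_z\in P$; and $\lceil P_z\rceil_z$ (the supremum for $\le_2$) is the set of all functions $(z,x)\mapsto(z,f_z(x))$, $x\in\operatorname{dom}(P_z)$, with $f_z\in P_z$ for every $z$. Let $\mathrm{rDiv}$ (robust division) be the set of all functions $d$ from $\{(u,v)\in\mathbb N^{\mathbb N}\times\mathbb N^{\mathbb N} \mid 0\le\rho(u)\le\rho(v)\}$ to $\mathbb N^{\mathbb N}$ with $\rho(d(u,v))=\rho(u)/\rho(v)$ whenever $\rho(v)>0$.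 For $n,m\ge1$, an $n\times m$ bimatrix game is a pair $(A,B)$ of real $n\times m$ matrices; with $S^k$ the set of non-negative vectors in $\mathbb R^k$ with coordinate sum $1$, a Nash equilibrium of it is a pair $(\hat x,\hat y)\in S^n\times S^m$ with $\hat x^TA\hat y\ge x^TA\hat y$ for all $x\in S^n$ and $\hat x^TB\hat y\ge\hat x^TBy$ for all $y\in S^m$. A name of $(A,B)$ is a sequence $0^n1^m0\langle w^a,w^b\rangle$ where $w^a$ and $w^b$ are the interleavings of $\rho$-names of the $nm$ entries of $A$ and of $B$ (column by column) and $\langle\ ,\ \rangle$ is the interleaving of two sequences; a name of a pair $(x,y)\in\mathbb R^n\times\mathbb R^m$ is a sequence $0^n1^m0\langle w^x,w^y\rangle$ where $w^x$ and $w^y$ are the interleavings of $\rho$-names of the coordinates of $x$ and of $y$. Let $\mathrm{Nash}$ be the set of all functions that map each name of a bimatrix game, of any size, to a name of one of its Nash equilibria. Then $$\mathrm{Nash}\ \le_2\ \lceil\langle\mathrm{rDiv}\rangle^z\rceil_{z\ge1}.$$ -/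

import Mathlib

/-!
Multivalued functions, Type-2 reducibility (continuous reductions), robust division and the problem
of finding Nash equilibria of bimatrix games with real payoffs.
-/

/-- Infinite sequences of natural numbers, with the product of the discrete topologies. -/
abbrev Baire : Type := ℕ → ℕ

/-- A multivalued function from `X` to `Y`, identified with the set of its choice functions: a domain
together with a set of functions, all of them defined on exactly this domain. -/
structure MultiFun (X Y : Type) where
  dom : Set X
  choices : Set (dom → Y)

namespace MultiFun

/-- Type-2 reducibility `A ≤₂ B`: there are continuous partial functions `F`, `G` such that
`w ↦ F (w, g (G w))` is in `A` for each `g` in `B`. As the members of `A` have the domain `A.dom` and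
`g` has the domain `B.dom`, the function `G` maps `A.dom` to `B.dom`. The domain `D` of `F` has to
contain all the pairs `(w, g (G w))`. Continuity is with respect to the subspace topologies. -/
def Reduces {X Y U V : Type} [TopologicalSpace X] [TopologicalSpace Y]
    [TopologicalSpace U] [TopologicalSpace V] (A : MultiFun X Y) (B : MultiFun U V) : Prop :=
  ∃ (G : A.dom → B.dom) (D : Set (X × V)) (F : D → Y), Continuous G ∧ Continuous F ∧
    ∀ g ∈ B.choices, ∃ h : ∀ w : A.dom, ((w : X), g (G w)) ∈ D,
      (fun w : A.dom => F ⟨((w : X), g (G w)), h w⟩) ∈ A.choices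

/-- The product of `z` copies of `P`: all the functions
`(x₁, …, x_z) ↦ (f₁ x₁, …, f_z x_z)` with `f₁, …, f_z` in `P`. -/
def power {X Y : Type} (P : MultiFun X Y) (z : ℕ) : MultiFun (Fin z → X) (Fin z → Y) where
  dom := {x | ∀ i, x i ∈ P.dom}
  choices := {h | ∃ f : Fin z → P.dom → Y, (∀ i, f i ∈ P.choices) ∧
    ∀ x, h x = fun i => f i ⟨x.1 i, x.2 i⟩}

/-- The supremum of a family of multivalued functions: all the functions
`(i, x) ↦ (i, f i x)`, with `f i` in `P i` for every `i`, on the disjoint union of the domains. -/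
def sup {ι : Type} {X Y : ι → Type} (P : ∀ i, MultiFun (X i) (Y i)) :
    MultiFun (Σ i, X i) (Σ i, Y i) where
  dom := {s | s.2 ∈ (P s.1).dom}
  choices := {h | ∃ f : ∀ i, (P i).dom → Y i, (∀ i, f i ∈ (P i).choices) ∧
    ∀ s, h s = ⟨s.1.1, f s.1.1 ⟨s.1.2, s.2⟩⟩}

end MultiFun

/-- The standard representation of the reals: `w` is a name of `x` with respect to the numbering `ν`
of the rationals. -/
def IsRealName (ν : ℕ ≃ ℚ) (w : Baire) (x : ℝ) : Prop :=
  ∀ i : ℕ, |((ν (w i) : ℚ) : ℝ) - x| ≤ (1 / 2 : ℝ) ^ i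

/-- Robust division. The defining condition says nothing about the value of `d` on names of pairs
`(0, 0)`. -/
def rDiv (ν : ℕ ≃ ℚ) : MultiFun (Baire × Baire) Baire where
  dom := {p | ∃ x y : ℝ, IsRealName ν p.1 x ∧ IsRealName ν p.2 y ∧ 0 ≤ x ∧ x ≤ y}
  choices := {d | ∀ p, ∀ x y : ℝ, IsRealName ν p.1.1 x → IsRealName ν p.1.2 y → 0 < y →
    IsRealName ν (d p) (x / y)}

/-- The component `p_j` of an interleaved tuple `w = ⟨p_0, …, p_{k-1}⟩`, where
`⟨p_0, …, p_{k-1}⟩ (k * t + j) = p_j t` for `j < k`. -/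
def component (k j : ℕ) (w : Baire) : Baire := fun t => w (k * t + j)

/-- `w = 0ⁿ 1ᵐ 0 w₂` for some sequence `w₂`. -/
def HasSizePrefix (w : Baire) (n m : ℕ) : Prop :=
  (∀ i < n, w i = 0) ∧ (∀ i < m, w (n + i) = 1) ∧ w (n + m) = 0

/-- The remaining sequence `w₂` of `w = 0ⁿ 1ᵐ 0 w₂`. -/
def dropPrefix (n m : ℕ) (w : Baire) : Baire := fun t => w (n + m + 1 + t)

/-- `w = 0ⁿ 1ᵐ 0 ⟨wᵃ, wᵇ⟩` is a name of the `n × m` bimatrix game `(A, B)`, where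
`n, m ≥ 1` and `wᵃ`, `wᵇ` are the tuples of names of the entries of `A`, `B`, column by column. -/
def IsGameName (ν : ℕ ≃ ℚ) (w : Baire) {n m : ℕ} (A B : Matrix (Fin n) (Fin m) ℝ) : Prop :=
  0 < n ∧ 0 < m ∧ HasSizePrefix w n m ∧
  (∀ (i : Fin n) (j : Fin m), IsRealName ν
    (component (n * m) (n * (j : ℕ) + i) (component 2 0 (dropPrefix n m w))) (A i j)) ∧
  (∀ (i : Fin n) (j : Fin m), IsRealName ν
    (component (n * m) (n * (j : ℕ) + i) (component 2 1 (dropPrefix n m w))) (B i j))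

/-- `w = 0ⁿ 1ᵐ 0 ⟨wˣ, wʸ⟩` is a name of the pair `(x, y)` of vectors, where `wˣ`, `wʸ` are the
tuples of names of the entries of `x`, `y`. -/
def IsStrategyPairName (ν : ℕ ≃ ℚ) (w : Baire) {n m : ℕ} (x : Fin n → ℝ) (y : Fin m → ℝ) : Prop :=
  HasSizePrefix w n m ∧
  (∀ i : Fin n, IsRealName ν (component n i (component 2 0 (dropPrefix n m w))) (x i)) ∧
  (∀ j : Fin m, IsRealName ν (component m j (component 2 1 (dropPrefix n m w))) (y j))

open scoped Matrix in
/-- `(x, y)` is a Nash equilibrium of the bimatrix game `(A, B)`. -/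
def IsNashEquilibrium {n m : ℕ} (A B : Matrix (Fin n) (Fin m) ℝ)
    (x : Fin n → ℝ) (y : Fin m → ℝ) : Prop :=
  x ∈ stdSimplex ℝ (Fin n) ∧ y ∈ stdSimplex ℝ (Fin m) ∧
  (∀ x' ∈ stdSimplex ℝ (Fin n), x' ⬝ᵥ (A *ᵥ y) ≤ x ⬝ᵥ (A *ᵥ y)) ∧
  (∀ y' ∈ stdSimplex ℝ (Fin m), x ⬝ᵥ (B *ᵥ y') ≤ x ⬝ᵥ (B *ᵥ y))

/-- The problem of finding, from a name of a bimatrix game of arbitrary size, a name of one of its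
Nash equilibria. -/
def Nash (ν : ℕ ≃ ℚ) : MultiFun Baire Baire where
  dom := {w | ∃ (n m : ℕ) (A B : Matrix (Fin n) (Fin m) ℝ), IsGameName ν w A B}
  choices := {f | ∀ w, ∀ (n m : ℕ) (A B : Matrix (Fin n) (Fin m) ℝ), IsGameName ν w.1 A B →
    ∃ (x : Fin n → ℝ) (y : Fin m → ℝ), IsNashEquilibrium A B x y ∧
      IsStrategyPairName ν (f w) x y}

/-!
# Nash equilibria of bimatrix games by parallel robust divisions

A robust division evaluates, at a point `x`, a function with values in `[0, 1]` that is continuous on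
an open set `U`: divide `d x * f x` by `d x`, where `d` is the distance from the complement of `U`. If
`x ∉ U`, the outcome is arbitrary (`parDiv_of_continuousOn`). Everything is built from such
evaluations, which do not depend on each other's outcomes; only the final continuous function
combines the outcomes.

*Points of polytopes.* For given supports, the equilibria of a game form a product of two polytopes
`P x` that are given by linear inequalities with coefficients depending on the game. Every vertex is
the only solution of the equations that belong to its tight constraints, hence one of finitely many
candidates, each defined and continuous on an open set (`polytope_eq_convexHull`). The number of
undefined candidates, together with the number of candidates that belong to `P x`, defines finitely
many strata (`stratum`), indexed such that the points with index at most `s` form an open set, in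
which the stratum `s` is closed. On each stratum the vertices are continuous. Divisions yield, for every
`s`, finitely many points and a radius which describe a map of the ambient space (`moveNear`): at
points with index at most `s` it fixes `P x`, and on the stratum `s` it maps everything into `P x`
(`parDiv_moveNear`). This uses the extension theorem of Tietze for the vertices, the continuity of
the nearest point in a convex hull, and a radius that vanishes on the stratum but bounds how far
`P x` is from the convex hull of the extended vertices. The composition of these maps, by increasing
`s`, ends in `P x`: the maps before the stratum of `x` are arbitrary, the one of the stratum leads
into `P x`, and the later ones fix `P x` (`parDiv_of_vertices`).

*Choice of the supports.* The games that have an equilibrium with given supports form a closed set,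
and finitely many of these sets cover the space of games. Divisions that are carried out in parallel
with the other ones make it possible to choose one of the sets that contain the game
(`exists_parDiv_selection`). The choice is not a continuous function of real numbers, but on names it
is one, because the Baire space is zero-dimensional (`HasClopenNhds.exists_continuous_choice`).

*Existence.* Equilibria exist (`exists_isNashEquilibrium`) as limits of fixed points of smooth logit
responses. These exist by Brouwer's theorem for smooth maps, which follows from the absence of `C¹`
retractions of a ball onto its sphere (`not_contDiffAt_retraction_sphere`), shown by comparing volumes.
-/

/-! ### Maps of a ball onto its boundary sphere -/

theorem Lagrange.exists_eval_eq_sum_mul_eval {t : ℕ → ℝ} (ht : Function.Injective t) (d : ℕ)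
    (a : ℝ) :
    ∃ w : ℕ → ℝ, ∀ p : Polynomial ℝ, p.natDegree ≤ d →
      p.eval a = ∑ j ∈ Finset.range (d + 1), w j * p.eval (t j) := by
  classical
  refine ⟨fun j => (Lagrange.basis (Finset.range (d + 1)) t j).eval a, fun p hp => ?_⟩
  have hdeg : p.degree < ((Finset.range (d + 1)).card : ℕ) := by
    rw [Finset.card_range]
    exact lt_of_le_of_lt Polynomial.degree_le_natDegree (by exact_mod_cast Nat.lt_succ_of_le hp)
  conv_lhs => rw [Lagrange.eq_interpolate (s := Finset.range (d + 1)) (v := t) ht.injOn hdeg]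
  rw [Lagrange.interpolate_apply, Polynomial.eval_finsetSum]
  refine Finset.sum_congr rfl fun j _ => ?_
  rw [Polynomial.eval_mul, Polynomial.eval_C, mul_comm]

section Ball

variable {E : Type*} [NormedAddCommGroup E] [InnerProductSpace ℝ E]

open Metric MeasureTheory

/-- A map that vanishes on the sphere and is Lipschitz on the ball stays Lipschitz when it is
extended by zero. -/
theorem norm_indicator_closedBall_sub_le {g : E → E} {R L : ℝ} (hL : 0 ≤ L)
    (hg : ∀ x ∈ closedBall (0 : E) R, ∀ y ∈ closedBall (0 : E) R, ‖g x - g y‖ ≤ L * ‖x - y‖)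
    (h0 : ∀ x, ‖x‖ = R → g x = 0) (x y : E) :
    ‖(closedBall 0 R).indicator g x - (closedBall 0 R).indicator g y‖ ≤ L * ‖x - y‖ := by
  classical
  have key : ∀ x ∈ closedBall (0 : E) R, ∀ y ∉ closedBall (0 : E) R, ‖g x‖ ≤ L * ‖x - y‖ := by
    intro x hx y hy
    have hc : ContinuousOn (fun s : ℝ => ‖x + s • (y - x)‖) (Set.Icc 0 1) := by fun_prop
    simp only [mem_closedBall, dist_zero_right, not_le] at hx hy
    obtain ⟨s, hs, hsR⟩ := intermediate_value_Icc zero_le_one hc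
      (show R ∈ Set.Icc _ _ by constructor <;> simp <;> linarith)
    have h1 := hg x (by simpa using hx) (x + s • (y - x)) (by simpa using hsR.le)
    rw [h0 _ hsR, sub_zero] at h1
    refine h1.trans ?_
    gcongr
    rw [show x - (x + s • (y - x)) = s • (x - y) by module, norm_smul, Real.norm_of_nonneg hs.1]
    exact mul_le_of_le_one_left (norm_nonneg _) hs.2
  by_cases hx : x ∈ closedBall (0 : E) R <;> by_cases hy : y ∈ closedBall (0 : E) R
  · simpa [Set.indicator_of_mem hx, Set.indicator_of_mem hy] using hg x hx y hy
  · simpa [Set.indicator_of_mem hx, Set.indicator_of_notMem hy] using key x hx y hy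
  · rw [norm_sub_rev, norm_sub_rev x]
    simpa [Set.indicator_of_mem hy, Set.indicator_of_notMem hx] using key y hy x hx
  · simp only [Set.indicator_of_notMem hx, Set.indicator_of_notMem hy, sub_self, norm_zero]
    positivity

variable [FiniteDimensional ℝ E]

theorem ContinuousLinearMap.exists_polynomial_det_one_add_smul (N : E →L[ℝ] E) :
    ∃ p : Polynomial ℝ, p.natDegree ≤ Module.finrank ℝ E ∧
      ∀ t : ℝ, (1 + t • N : E →L[ℝ] E).det = p.eval t := by
  classical
  let b := Module.finBasis ℝ E
  let M := LinearMap.toMatrix b b (N : E →ₗ[ℝ] E)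
  refine ⟨((Polynomial.X : Polynomial ℝ) • M.map Polynomial.C
    + (1 : Matrix _ _ ℝ).map Polynomial.C).det, ?_, fun t => ?_⟩
  · simpa using Polynomial.natDegree_det_X_add_C_le M 1
  · rw [← Polynomial.coe_evalRingHom, RingHom.map_det]
    change LinearMap.det ((1 + t • N : E →L[ℝ] E) : E →ₗ[ℝ] E) = _
    rw [← LinearMap.det_toMatrix b]
    congr 1
    ext i j
    simp [M, LinearMap.toMatrix_apply, Matrix.one_apply, Finsupp.single_apply, add_comm, eq_comm]
    split_ifs <;> simp [mul_comm]

/-- A small multiple of a linear map does not change the sign of the determinant of the identity. -/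
theorem ContinuousLinearMap.det_one_add_smul_pos (N : E →L[ℝ] E) {t : ℝ} (ht : 0 ≤ t)
    (h : t * ‖N‖ < 1) : 0 < (1 + t • N : E →L[ℝ] E).det := by
  have hne : ∀ s ∈ Set.Icc 0 t, (1 + s • N : E →L[ℝ] E).det ≠ 0 := by
    intro s hs h0
    obtain ⟨v, hv, hv0⟩ := (Submodule.ne_bot_iff _).1 (LinearMap.bot_lt_ker_of_det_eq_zero h0).ne'
    have hv' : v + s • N v = 0 := by simpa using hv
    have h1 : ‖v‖ ≤ s * (‖N‖ * ‖v‖) := by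
      have : v = -(s • N v) := eq_neg_of_add_eq_zero_left hv'
      calc ‖v‖ = s * ‖N v‖ := by
            conv_lhs => rw [this]
            rw [norm_neg, norm_smul, Real.norm_of_nonneg hs.1]
        _ ≤ _ := by gcongr; exacts [hs.1, N.le_opNorm v]
    have h2 : s * ‖N‖ ≤ t * ‖N‖ := by gcongr; exact hs.2
    have h3 : 0 < ‖v‖ := norm_pos_iff.2 hv0
    nlinarith
  have hc : ContinuousOn (fun s : ℝ => (1 + s • N : E →L[ℝ] E).det) (Set.Icc 0 t) :=
    (ContinuousLinearMap.continuous_det.comp (by fun_prop)).continuousOn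
  by_contra hneg
  have h1 : (1 + (0 : ℝ) • N : E →L[ℝ] E).det = 1 := by
    simp [ContinuousLinearMap.det]
  obtain ⟨s, hs, hs0⟩ := intermediate_value_Icc' ht hc
    ⟨not_lt.1 hneg, by simp only [h1]; exact zero_le_one⟩
  exact hne s hs hs0

/-- For small `t` the map `x ↦ x + t g x` permutes the open ball. -/
theorem bijOn_ball_add_smul {g : E → E} {R L t : ℝ} (hL : 0 ≤ L)
    (hg : ∀ x ∈ closedBall (0 : E) R, ∀ y ∈ closedBall (0 : E) R, ‖g x - g y‖ ≤ L * ‖x - y‖)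
    (h0 : ∀ x, ‖x‖ = R → g x = 0) (hR : ∀ x ∈ closedBall (0 : E) R, ‖x + g x‖ ≤ R)
    (ht : 0 ≤ t) (ht1 : t < 1) (htL : t * L < 1) :
    Set.BijOn (fun x => x + t • g x) (ball 0 R) (ball 0 R) := by
  refine ⟨fun x hx => ?_, fun x hx y hy hxy => ?_, fun y hy => ?_⟩
  · have h1 := hR x (ball_subset_closedBall hx)
    simp only [mem_ball, dist_zero_right] at hx ⊢
    calc ‖x + t • g x‖ = ‖(1 - t) • x + t • (x + g x)‖ := by congr 1; module
      _ ≤ ‖(1 - t) • x‖ + ‖t • (x + g x)‖ := norm_add_le _ _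
      _ = (1 - t) * ‖x‖ + t * ‖x + g x‖ := by
        rw [norm_smul, norm_smul, Real.norm_of_nonneg ht, Real.norm_of_nonneg (by linarith)]
      _ < R := by nlinarith
  · have h1 := hg x (ball_subset_closedBall hx) y (ball_subset_closedBall hy)
    have h2 : x - y = -(t • (g x - g y)) := by
      have : x + t • g x = y + t • g y := hxy
      rw [smul_sub, neg_sub, sub_eq_sub_iff_add_eq_add, this, add_comm]
    have h3 : ‖x - y‖ = t * ‖g x - g y‖ := by
      rw [h2, norm_neg, norm_smul, Real.norm_of_nonneg ht]
    have h4 : ‖x - y‖ ≤ 0 := by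
      have := norm_nonneg (x - y)
      nlinarith
    exact sub_eq_zero.1 (norm_le_zero_iff.1 h4)
  · let G := (closedBall (0 : E) R).indicator g
    have hG := norm_indicator_closedBall_sub_le hL hg h0
    have hc : ContractingWith (NNReal.mk (t * L) (by positivity)) (fun x => y - t • G x) := by
      refine ⟨by exact_mod_cast htL, LipschitzWith.of_dist_le_mul fun a b => ?_⟩
      rw [dist_eq_norm, dist_eq_norm]
      calc ‖y - t • G a - (y - t • G b)‖ = ‖t • (G b - G a)‖ := by congr 1; module
        _ = t * ‖G a - G b‖ := by rw [norm_smul, Real.norm_of_nonneg ht, norm_sub_rev]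
        _ ≤ t * (L * ‖a - b‖) := by gcongr; exact hG a b
        _ = t * L * ‖a - b‖ := by ring
    have hx := hc.fixedPoint_isFixedPt
    set x := ContractingWith.fixedPoint _ hc
    have hx : y - t • G x = x := hx
    have hxR : x ∈ ball (0 : E) R := by
      by_contra hn
      have hG0 : G x = 0 := by
        by_cases hm : x ∈ closedBall (0 : E) R
        · simp only [G, Set.indicator_of_mem hm]
          simp only [mem_ball, mem_closedBall, dist_zero_right] at hn hm
          exact h0 x (by linarith)
        · exact Set.indicator_of_notMem hm g
      rw [hG0, smul_zero, sub_zero] at hx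
      exact hn (hx ▸ hy)
    refine ⟨x, hxR, ?_⟩
    have : G x = g x := Set.indicator_of_mem (ball_subset_closedBall hxR) g
    rw [this] at hx
    exact (sub_eq_iff_eq_add.1 hx).symm

/-- There is no `C¹` retraction of a ball onto its boundary sphere. If `f = id + g` were one, the
integral of `det (1 + t Dg)` over the ball would be the volume of the ball for all small `t ≥ 0`, as
`id + t g` permutes the ball. The integrand is a polynomial in `t`, so the integral would be the
volume also for `t = 1`, where the integrand is `det Df = 0`. -/
theorem not_contDiffAt_retraction_sphere {R : ℝ} (hR : 0 < R) (f : E → E)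
    (hf : ∀ x ∈ closedBall (0 : E) R, ContDiffAt ℝ 1 f x) (hid : ∀ x, ‖x‖ = R → f x = x)
    (hn : ∀ x ∈ closedBall (0 : E) R, ‖f x‖ = R) : False := by
  borelize E
  let μ : Measure E := Measure.addHaar
  let g : E → E := fun x => f x - x
  let g' : E → E →L[ℝ] E := fun x => fderiv ℝ f x - 1
  have hg' : ∀ x ∈ closedBall (0 : E) R, HasFDerivAt g (g' x) x := fun x hx =>
    ((hf x hx).differentiableAt one_ne_zero).hasFDerivAt.sub (hasFDerivAt_id x)
  have hcont : ContinuousOn g' (closedBall (0 : E) R) := fun x hx =>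
    (((hf x hx).continuousAt_fderiv one_ne_zero).sub continuousAt_const).continuousWithinAt
  obtain ⟨L, hL⟩ := (isCompact_closedBall (0 : E) R).exists_bound_of_continuousOn hcont
  have hL0 : 0 ≤ L := (norm_nonneg _).trans (hL 0 (mem_closedBall_self hR.le))
  have hlip : ∀ x ∈ closedBall (0 : E) R, ∀ y ∈ closedBall (0 : E) R,
      ‖g x - g y‖ ≤ L * ‖x - y‖ := fun x hx y hy =>
    (convex_closedBall (0 : E) R).norm_image_sub_le_of_norm_hasFDerivWithin_le
      (fun z hz => (hg' z hz).hasFDerivWithinAt) hL hy hx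
  have hsmall : ∀ t : ℝ, 0 ≤ t → t < 1 → t * L < 1 →
      ∫ x in ball (0 : E) R, (1 + t • g' x : E →L[ℝ] E).det ∂μ = μ.real (ball 0 R) := by
    intro t ht ht1 htL
    have hb := bijOn_ball_add_smul hL0 hlip (fun x hx => by simp [g, hid x hx])
      (fun x hx => by simpa [g] using (hn x hx).le) ht ht1 htL
    have h1 := integral_image_eq_integral_abs_det_fderiv_smul μ (s := ball (0 : E) R)
      (f := fun x => x + t • g x) (f' := fun x => 1 + t • g' x) measurableSet_ball
      (fun x hx => ((hasFDerivAt_id x).add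
        ((hg' x (ball_subset_closedBall hx)).const_smul t)).hasFDerivWithinAt)
      hb.injOn (fun _ => (1 : ℝ))
    rw [hb.image_eq] at h1
    simp only [smul_eq_mul, mul_one, integral_const, MeasurableSet.univ, measureReal_restrict_apply,
      Set.univ_inter] at h1
    rw [h1]
    refine setIntegral_congr_fun measurableSet_ball fun x hx => ?_
    have hpos := (g' x).det_one_add_smul_pos ht (lt_of_le_of_lt
      (mul_le_mul_of_nonneg_left (hL x (ball_subset_closedBall hx)) ht) htL)
    exact (abs_of_pos hpos).symm
  have hint : ∀ t : ℝ, IntegrableOn (fun x => (1 + t • g' x : E →L[ℝ] E).det) (ball (0 : E) R) μ :=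
    fun t => (ContinuousOn.integrableOn_compact (isCompact_closedBall _ _)
      (ContinuousLinearMap.continuous_det.comp_continuousOn
        (continuousOn_const.add (hcont.const_smul t)))).mono_set ball_subset_closedBall
  -- Nodes in the interval where `hsmall` applies.
  let t : ℕ → ℝ := fun j => (1 / (L + 1)) / (j + 2)
  have htpos : ∀ j, 0 < t j := fun j => by positivity
  have ht : ∀ j, t j < 1 ∧ t j * L < 1 := by
    intro j
    have h1 : t j * ((L + 1) * (j + 2)) = 1 := by simp only [t]; field_simp
    have h2 : (0 : ℝ) ≤ j := Nat.cast_nonneg j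
    have h3 : (L + 1) * 2 ≤ (L + 1) * (j + 2) := by gcongr; linarith
    have h4 := htpos j
    have h5 := mul_le_mul_of_nonneg_left h3 h4.le
    constructor <;> nlinarith
  have htinj : Function.Injective t := by
    intro i j hij
    have hc : 1 / (L + 1) ≠ 0 := by positivity
    have h2 : ((i : ℝ) + 2) = j + 2 := by
      have h3 : (1 / (L + 1)) / ((i : ℝ) + 2) = (1 / (L + 1)) / (j + 2) := hij
      have hi : ((i : ℝ) + 2) ≠ 0 := by positivity
      have hj : ((j : ℝ) + 2) ≠ 0 := by positivity
      rw [div_eq_div_iff hi hj] at h3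
      exact (mul_left_cancel₀ hc h3).symm
    exact_mod_cast add_right_cancel h2
  obtain ⟨w, hw⟩ := Lagrange.exists_eval_eq_sum_mul_eval htinj (Module.finrank ℝ E) 1
  have hw1 : ∑ j ∈ Finset.range (Module.finrank ℝ E + 1), w j = 1 := by
    simpa using (hw 1 (by simp)).symm
  have hone : ∫ x in ball (0 : E) R, (1 + (1 : ℝ) • g' x : E →L[ℝ] E).det ∂μ
      = μ.real (ball 0 R) := by
    calc ∫ x in ball (0 : E) R, (1 + (1 : ℝ) • g' x : E →L[ℝ] E).det ∂μ
        = ∫ x in ball (0 : E) R, ∑ j ∈ Finset.range (Module.finrank ℝ E + 1),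
            w j * (1 + t j • g' x : E →L[ℝ] E).det ∂μ := by
          refine setIntegral_congr_fun measurableSet_ball fun x _ => ?_
          obtain ⟨p, hp, hpe⟩ := (g' x).exists_polynomial_det_one_add_smul
          simp only [hpe]
          exact hw p hp
      _ = ∑ j ∈ Finset.range (Module.finrank ℝ E + 1),
            w j * ∫ x in ball (0 : E) R, (1 + t j • g' x : E →L[ℝ] E).det ∂μ := by
          rw [integral_finsetSum _ fun j _ => (hint (t j)).const_mul (w j)]
          simp only [integral_const_mul]
      _ = _ := by
          simp only [hsmall _ (htpos _).le (ht _).1 (ht _).2]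
          rw [← Finset.sum_mul, hw1, one_mul]
  have hzero : ∫ x in ball (0 : E) R, (1 + (1 : ℝ) • g' x : E →L[ℝ] E).det ∂μ = 0 := by
    rw [setIntegral_congr_fun (g := fun _ => (0 : ℝ)) measurableSet_ball, integral_zero]
    intro x hx
    have hfx := (hf x (ball_subset_closedBall hx)).differentiableAt one_ne_zero
    have hloc : (fun z => inner ℝ (f z) (f z)) =ᶠ[nhds x] fun _ => R ^ 2 := by
      filter_upwards [isOpen_ball.mem_nhds hx] with z hz
      rw [real_inner_self_eq_norm_sq, hn z (ball_subset_closedBall hz)]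
    have hder : ∀ v, inner ℝ (f x) (fderiv ℝ f x v) = 0 := by
      intro v
      have h1 := hfx.hasFDerivAt.inner ℝ hfx.hasFDerivAt
      have h2 := h1.unique ((hasFDerivAt_const (R ^ 2) x).congr_of_eventuallyEq hloc)
      have h3 := DFunLike.congr_fun h2 v
      simp only [ContinuousLinearMap.comp_apply, ContinuousLinearMap.prod_apply,
        fderivInnerCLM_apply, zero_apply] at h3
      rw [real_inner_comm (f x)] at h3
      rw [real_inner_comm]
      linarith [real_inner_comm (f x) (fderiv ℝ f x v)]
    have hval : (1 + (1 : ℝ) • g' x : E →L[ℝ] E) = fderiv ℝ f x := by simp [g']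
    simp only [hval]
    by_contra hdet
    obtain ⟨v, hv⟩ := (LinearMap.equivOfDetNeZero ((fderiv ℝ f x : E →L[ℝ] E) : E →ₗ[ℝ] E)
      hdet).surjective (f x)
    have hv' : fderiv ℝ f x v = f x := hv
    have h3 := hder v
    rw [hv', real_inner_self_eq_norm_sq, hn x (ball_subset_closedBall hx)] at h3
    exact (pow_pos hR 2).ne' h3
  have hvol : 0 < μ.real (ball (0 : E) R) :=
    ENNReal.toReal_pos (measure_ball_pos μ 0 hR).ne' measure_ball_lt_top.ne
  exact hvol.ne' (hone.symm.trans hzero)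

/-- Brouwer's theorem for a smooth map that maps a ball into its interior. Without a fixed point,
moving `x` along the ray from `p x` through `x` up to the sphere is a `C¹` retraction. -/
theorem exists_fixedPoint_of_contDiff {R : ℝ} (hR : 0 < R) (p : E → E) (hp : ContDiff ℝ 1 p)
    (hpR : ∀ x, ‖p x‖ < R) : ∃ x, p x = x := by
  by_contra! hne
  let w : E → E := fun x => x - p x
  have hw : ∀ x, w x ≠ 0 := fun x => sub_ne_zero.2 (hne x).symm
  have hwc : ContDiff ℝ 1 w := contDiff_id.sub hp
  let q : E → ℝ := fun x => inner ℝ x (w x) ^ 2 + ‖w x‖ ^ 2 * (R ^ 2 - ‖x‖ ^ 2)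
  have hqc : ContDiff ℝ 1 q := ((contDiff_id.inner ℝ hwc).pow 2).add
    ((hwc.norm_sq ℝ).mul (contDiff_const.sub (contDiff_id.norm_sq ℝ)))
  have hin : ∀ x, ‖x‖ = R → 0 < inner ℝ x (w x) := by
    intro x hx
    have h1 := real_inner_le_norm x (p x)
    have h2 := hpR x
    simp only [w, inner_sub_right, real_inner_self_eq_norm_sq]
    rw [hx] at h1 ⊢
    nlinarith
  have hq : ∀ x ∈ closedBall (0 : E) R, 0 < q x := by
    intro x hx
    rw [mem_closedBall, dist_zero_right] at hx
    have hw2 : 0 < ‖w x‖ ^ 2 := by have := norm_pos_iff.2 (hw x); positivity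
    rcases hx.lt_or_eq with h | h
    · have : 0 < R ^ 2 - ‖x‖ ^ 2 := by nlinarith [norm_nonneg x]
      positivity
    · have := hin x h
      simp only [q, h, sub_self, mul_zero, add_zero]
      positivity
  let s : E → ℝ := fun x => (Real.sqrt (q x) - inner ℝ x (w x)) / ‖w x‖ ^ 2
  have hs : ∀ x ∈ closedBall (0 : E) R, ContDiffAt ℝ 1 s x := fun x hx =>
    ((hqc.contDiffAt.sqrt (hq x hx).ne').sub (contDiff_id.inner ℝ hwc).contDiffAt).div
      (hwc.norm_sq ℝ).contDiffAt (pow_ne_zero 2 (norm_ne_zero_iff.2 (hw x)))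
  refine not_contDiffAt_retraction_sphere hR (fun x => x + s x • w x)
    (fun x hx => contDiffAt_id.add ((hs x hx).smul hwc.contDiffAt)) (fun x hx => ?_)
    (fun x hx => ?_)
  · have h1 : q x = inner ℝ x (w x) ^ 2 := by simp [q, hx]
    simp [s, h1, Real.sqrt_sq (hin x hx).le]
  · have hw2 : ‖w x‖ ^ 2 ≠ 0 := pow_ne_zero 2 (norm_ne_zero_iff.2 (hw x))
    have h1 : s x * ‖w x‖ ^ 2 + inner ℝ x (w x) = Real.sqrt (q x) := by
      simp only [s, div_mul_cancel₀ _ hw2, sub_add_cancel]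
    have h2 : (s x * ‖w x‖ ^ 2 + inner ℝ x (w x)) ^ 2 = q x := by
      rw [h1, Real.sq_sqrt (hq x hx).le]
    have h3 : ‖x + s x • w x‖ ^ 2 = R ^ 2 := by
      rw [norm_add_sq_real, norm_smul, inner_smul_right, mul_pow, Real.norm_eq_abs, sq_abs]
      have h4 : ‖w x‖ ^ 2 * (‖x‖ ^ 2 + 2 * (s x * inner ℝ x (w x)) + s x ^ 2 * ‖w x‖ ^ 2 - R ^ 2)
          = 0 := by
        simp only [q] at h2
        linear_combination h2
      rcases mul_eq_zero.1 h4 with h | h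
      · exact absurd h hw2
      · linarith
    exact (pow_left_inj₀ (norm_nonneg _) hR.le two_ne_zero).1 h3

end Ball

/-! ### Existence of Nash equilibria -/

section Equilibria

open scoped Matrix

/-- The logit response to the payoffs `a`: the weight of `i` is proportional to `exp (a i)`. -/
noncomputable def softmax {ι : Type*} [Fintype ι] (a : ι → ℝ) : ι → ℝ := fun i =>
  Real.exp (a i) / ∑ j, Real.exp (a j)

theorem sum_exp_pos {ι : Type*} [Fintype ι] [Nonempty ι] (a : ι → ℝ) : 0 < ∑ j, Real.exp (a j) :=
  Finset.sum_pos (fun _ _ => Real.exp_pos _) Finset.univ_nonempty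

theorem softmax_mem_stdSimplex {ι : Type*} [Fintype ι] [Nonempty ι] (a : ι → ℝ) :
    softmax a ∈ stdSimplex ℝ ι := by
  refine ⟨fun i => div_nonneg (Real.exp_pos _).le (sum_exp_pos a).le, ?_⟩
  simp only [softmax]
  rw [← Finset.sum_div, div_self (sum_exp_pos a).ne']

/-- The logit response to the payoffs `c * a` is almost a best response to `a` if `c` is large. -/
theorem le_dotProduct_softmax {ι : Type*} [Fintype ι] [Nonempty ι] (a : ι → ℝ) {c : ℝ}
    (hc : 0 < c) (i : ι) : a i ≤ softmax (c • a) ⬝ᵥ a + Fintype.card ι / c := by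
  obtain ⟨h0, h1⟩ := softmax_mem_stdSimplex (c • a)
  have key : ∀ k, softmax (c • a) k * (a i - a k) ≤ 1 / c := by
    intro k
    have h2 : softmax (c • a) k * Real.exp (c * (a i - a k)) ≤ 1 := by
      have h3 : Real.exp (c * a i) ≤ ∑ j, Real.exp ((c • a) j) :=
        Finset.single_le_sum (f := fun j => Real.exp ((c • a) j))
          (fun _ _ => (Real.exp_pos _).le) (Finset.mem_univ i)
      rw [softmax, div_mul_eq_mul_div, div_le_one (sum_exp_pos _), ← Real.exp_add]
      refine le_trans (le_of_eq ?_) h3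
      congr 1
      simp only [Pi.smul_apply, smul_eq_mul]
      ring
    rw [le_div_iff₀ hc]
    calc softmax (c • a) k * (a i - a k) * c = softmax (c • a) k * (c * (a i - a k)) := by ring
      _ ≤ softmax (c • a) k * Real.exp (c * (a i - a k)) := by
        refine mul_le_mul_of_nonneg_left ?_ (h0 k)
        linarith [Real.add_one_le_exp (c * (a i - a k))]
      _ ≤ 1 := h2
  have h4 : ∑ k, softmax (c • a) k * (a i - a k) ≤ ∑ _k : ι, 1 / c :=
    Finset.sum_le_sum fun k _ => key k
  have h5 : ∑ k, softmax (c • a) k * (a i - a k) = a i - softmax (c • a) ⬝ᵥ a := by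
    simp only [mul_sub, Finset.sum_sub_distrib, ← Finset.sum_mul, dotProduct]
    rw [h1, one_mul]
  rw [h5, Finset.sum_const, Finset.card_univ, nsmul_eq_mul, mul_one_div] at h4
  linarith

theorem dotProduct_le_of_mem_stdSimplex {ι : Type*} [Fintype ι] {x a : ι → ℝ} {c : ℝ}
    (hx : x ∈ stdSimplex ℝ ι) (h : ∀ i, a i ≤ c) : x ⬝ᵥ a ≤ c := by
  calc x ⬝ᵥ a ≤ ∑ i, x i * c := Finset.sum_le_sum fun i _ =>
        mul_le_mul_of_nonneg_left (h i) (hx.1 i)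
    _ = c := by rw [← Finset.sum_mul, hx.2, one_mul]

/-- It is enough to compare a strategy with the pure strategies. -/
theorem isNashEquilibrium_of_pure {n m : ℕ} {A B : Matrix (Fin n) (Fin m) ℝ} {x : Fin n → ℝ}
    {y : Fin m → ℝ} (hx : x ∈ stdSimplex ℝ (Fin n)) (hy : y ∈ stdSimplex ℝ (Fin m))
    (hA : ∀ i, (A *ᵥ y) i ≤ x ⬝ᵥ (A *ᵥ y)) (hB : ∀ j, (x ᵥ* B) j ≤ x ⬝ᵥ (B *ᵥ y)) :
    IsNashEquilibrium A B x y :=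
  ⟨hx, hy, fun _ hx' => dotProduct_le_of_mem_stdSimplex hx' hA, fun y' hy' => by
    rw [Matrix.dotProduct_mulVec, dotProduct_comm]
    exact dotProduct_le_of_mem_stdSimplex hy' hB⟩

theorem exists_logit_equilibrium {n m : ℕ} (hn : 0 < n) (hm : 0 < m)
    (A B : Matrix (Fin n) (Fin m) ℝ) (c : ℝ) :
    ∃ (x : Fin n → ℝ) (y : Fin m → ℝ),
      x = softmax (c • (A *ᵥ y)) ∧ y = softmax (c • (x ᵥ* B)) := by
  have : Nonempty (Fin n) := ⟨⟨0, hn⟩⟩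
  have : Nonempty (Fin m) := ⟨⟨0, hm⟩⟩
  let p : EuclideanSpace ℝ (Fin n ⊕ Fin m) → EuclideanSpace ℝ (Fin n ⊕ Fin m) := fun z => WithLp.toLp 2 (Sum.elim
    (softmax (c • (A *ᵥ fun j => z (Sum.inr j)))) (softmax (c • ((fun i => z (Sum.inl i)) ᵥ* B))))
  have hp : ContDiff ℝ 1 p := by
    rw [contDiff_euclidean]
    rintro (i | j)
    · refine ContDiff.div ?_ (ContDiff.sum fun k _ => ?_) fun z => (sum_exp_pos _).ne' <;>
      · simp only [Pi.smul_apply, Matrix.mulVec, dotProduct]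
        fun_prop
    · refine ContDiff.div ?_ (ContDiff.sum fun k _ => ?_) fun z => (sum_exp_pos _).ne' <;>
      · simp only [Pi.smul_apply, Matrix.vecMul, dotProduct]
        fun_prop
  have hbound : ∀ {ι : Type} [Fintype ι] [Nonempty ι] (a : ι → ℝ) (i : ι), softmax a i ^ 2 ≤ 1 := by
    intro ι _ _ a i
    have h := softmax_mem_stdSimplex a
    have h0 := h.1 i
    have h1 : softmax a i ≤ 1 := by
      rw [← h.2]
      exact Finset.single_le_sum (fun j _ => h.1 j) (Finset.mem_univ i)
    nlinarith
  obtain ⟨z, hz⟩ := exists_fixedPoint_of_contDiff (R := n + m + 1) (by positivity) p hp (by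
    intro z
    have h1 : ‖p z‖ ^ 2 ≤ n + m := by
      rw [EuclideanSpace.norm_sq_eq]
      calc ∑ i, ‖p z i‖ ^ 2 ≤ ∑ _i : Fin n ⊕ Fin m, (1 : ℝ) := by
            refine Finset.sum_le_sum fun i _ => ?_
            rw [Real.norm_eq_abs, sq_abs]
            rcases i with i | j
            · exact hbound _ i
            · exact hbound _ j
        _ = n + m := by simp
    have h2 := norm_nonneg (p z)
    nlinarith)
  refine ⟨fun i => z (Sum.inl i), fun j => z (Sum.inr j), ?_, ?_⟩
  · funext i
    exact (congrArg (fun u : EuclideanSpace ℝ (Fin n ⊕ Fin m) => u (Sum.inl i)) hz).symm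
  · funext j
    exact (congrArg (fun u : EuclideanSpace ℝ (Fin n ⊕ Fin m) => u (Sum.inr j)) hz).symm

/-- Nash's theorem for bimatrix games: limits of logit equilibria are Nash equilibria. -/
theorem exists_isNashEquilibrium {n m : ℕ} (hn : 0 < n) (hm : 0 < m)
    (A B : Matrix (Fin n) (Fin m) ℝ) : ∃ x y, IsNashEquilibrium A B x y := by
  have : Nonempty (Fin n) := ⟨⟨0, hn⟩⟩
  have : Nonempty (Fin m) := ⟨⟨0, hm⟩⟩
  let F : ℕ → Set ((Fin n → ℝ) × (Fin m → ℝ)) := fun k =>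
    (stdSimplex ℝ (Fin n) ×ˢ stdSimplex ℝ (Fin m)) ∩
      ({z | ∀ i, (A *ᵥ z.2) i ≤ z.1 ⬝ᵥ (A *ᵥ z.2) + n / (k + 1 : ℝ)} ∩
       {z | ∀ j, (z.1 ᵥ* B) j ≤ z.1 ⬝ᵥ (B *ᵥ z.2) + m / (k + 1 : ℝ)})
  have hclosed : ∀ k, IsClosed (F k) := by
    intro k
    refine ((isClosed_stdSimplex ℝ (Fin n)).prod (isClosed_stdSimplex ℝ (Fin m))).inter (IsClosed.inter ?_ ?_)
    · simp only [Set.ofPred_forall]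
      refine isClosed_iInter fun i => isClosed_le ?_ ?_ <;>
      · simp only [Matrix.mulVec, dotProduct]
        fun_prop
    · simp only [Set.ofPred_forall]
      refine isClosed_iInter fun i => isClosed_le ?_ ?_ <;>
      · simp only [Matrix.mulVec, Matrix.vecMul, dotProduct]
        fun_prop
  have hcomp : IsCompact (F 0) :=
    ((isCompact_stdSimplex ℝ (Fin n)).prod (isCompact_stdSimplex ℝ (Fin m))).of_isClosed_subset
      (hclosed 0) Set.inter_subset_left
  have hmono : ∀ k, F (k + 1) ⊆ F k := by
    intro k z hz
    have h : ∀ d : ℕ, (d : ℝ) / ((k + 1 : ℕ) + 1 : ℝ) ≤ d / (k + 1 : ℝ) := by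
      intro d
      push_cast
      gcongr
      linarith
    exact ⟨hz.1, fun i => (hz.2.1 i).trans (add_le_add_right (h n) _),
      fun j => (hz.2.2 j).trans (add_le_add_right (h m) _)⟩
  have hne : ∀ k, (F k).Nonempty := by
    intro k
    obtain ⟨x, y, hx, hy⟩ := exists_logit_equilibrium hn hm A B (k + 1 : ℝ)
    have hk : (0 : ℝ) < k + 1 := by positivity
    refine ⟨(x, y), ⟨hx ▸ softmax_mem_stdSimplex _, hy ▸ softmax_mem_stdSimplex _⟩,
      fun i => ?_, fun j => ?_⟩
    · have h := le_dotProduct_softmax (A *ᵥ y) hk i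
      rw [← hx, Fintype.card_fin] at h
      exact h
    · have h := le_dotProduct_softmax (x ᵥ* B) hk j
      rw [← hy, Fintype.card_fin, dotProduct_comm, ← Matrix.dotProduct_mulVec] at h
      exact h
  obtain ⟨z, hz⟩ := IsCompact.nonempty_iInter_of_sequence_nonempty_isCompact_isClosed F hmono hne
    hcomp hclosed
  have hz' : ∀ k, z ∈ F k := Set.mem_iInter.1 hz
  have hlim : ∀ {a b : ℝ} {d : ℕ}, (∀ k : ℕ, a ≤ b + d / (k + 1 : ℝ)) → a ≤ b := by
    intro a b d h
    have h1 := (tendsto_const_div_atTop_nhds_zero_nat (d : ℝ)).comp (Filter.tendsto_add_atTop_nat 1)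
    have h2 := (tendsto_const_nhds (x := b)).add h1
    rw [add_zero] at h2
    exact ge_of_tendsto' h2 fun k => by simpa using h k
  exact ⟨z.1, z.2, isNashEquilibrium_of_pure (hz' 0).1.1 (hz' 0).1.2
    (fun i => hlim fun k => (hz' k).2.1 i) (fun j => hlim fun k => (hz' k).2.2 j)⟩

end Equilibria

/-! ### Nearest points in a varying convex hull -/

section NearestPoint

open Set
open scoped Pointwise

theorem exists_mem_convexHull_norm_sub_le {E J : Type*} [NormedAddCommGroup E] [NormedSpace ℝ E]
    [Fintype J] (v v' : J → E) {p : E} (hp : p ∈ convexHull ℝ (range v')) :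
    ∃ s ∈ convexHull ℝ (range v), ‖s - p‖ ≤ dist v v' := by
  have h : convexHull ℝ (range v') ⊆ convexHull ℝ (range v) + Metric.closedBall (0 : E) (dist v v') := by
    refine convexHull_min ?_ ((convex_convexHull ℝ _).add (convex_closedBall _ _))
    rintro _ ⟨j, rfl⟩
    refine ⟨v j, subset_convexHull ℝ _ (mem_range_self j), v' j - v j, ?_, add_sub_cancel _ _⟩
    rw [mem_closedBall_zero_iff, ← dist_eq_norm, dist_comm]
    exact dist_le_pi_dist v v' j
  obtain ⟨s, hs, b, hb, rfl⟩ := h hp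
  refine ⟨s, hs, ?_⟩
  rw [mem_closedBall_zero_iff] at hb
  simpa using hb

/-- The nearest point of `y` in the convex hull of finitely many points depends continuously on `y`
and on these points. -/
theorem exists_continuous_nearestPoint (E J : Type*) [NormedAddCommGroup E] [InnerProductSpace ℝ E]
    [Fintype J] [Nonempty J] :
    ∃ π : (J → E) × E → E, Continuous π ∧ (∀ v y, π (v, y) ∈ convexHull ℝ (range v)) ∧
      ∀ v, ∀ y ∈ convexHull ℝ (range v), π (v, y) = y := by
  have hex : ∀ z : (J → E) × E, ∃ p ∈ convexHull ℝ (range z.1),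
      ∀ s ∈ convexHull ℝ (range z.1), inner ℝ (z.2 - p) (s - p) ≤ 0 := by
    intro z
    obtain ⟨p, hp, h⟩ := exists_norm_eq_iInf_of_complete_convex (range_nonempty z.1).convexHull
      ((finite_range z.1).isCompact_convexHull ℝ).isComplete (convex_convexHull ℝ _) z.2
    exact ⟨p, hp, (norm_eq_iInf_iff_real_inner_le_zero (convex_convexHull ℝ _) hp).1 h⟩
  choose π hmem hπ using hex
  -- The inequality of Pythagoras, for the triangle `y`, `π (v, y)`, `s`.
  have hpyth : ∀ z, ∀ s ∈ convexHull ℝ (range z.1),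
      ‖z.2 - π z‖ ^ 2 + ‖s - π z‖ ^ 2 ≤ ‖z.2 - s‖ ^ 2 := by
    intro z s hs
    have h1 := norm_sub_sq_real (z.2 - π z) (s - π z)
    rw [sub_sub_sub_cancel_right] at h1
    linarith [hπ z s hs]
  refine ⟨π, continuous_iff_continuousAt.2 fun z₀ => ?_, fun v y => hmem (v, y), fun v y hy => ?_⟩
  · let D := ‖z₀.2 - π z₀‖
    let η : (J → E) × E → ℝ := fun z => dist z₀.1 z.1 + dist z.2 z₀.2
    have hbound : ∀ z, ‖π z - π z₀‖ ≤ η z + Real.sqrt (4 * η z * D + 4 * η z ^ 2) := by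
      intro z
      obtain ⟨s, hs, hsd⟩ := exists_mem_convexHull_norm_sub_le z₀.1 z.1 (hmem z)
      obtain ⟨s₀, hs₀, hs₀d⟩ := exists_mem_convexHull_norm_sub_le z.1 z₀.1 (hmem z₀)
      rw [dist_comm] at hs₀d
      have h1 : ‖z.2 - π z‖ ≤ ‖z.2 - s₀‖ := by
        refine (pow_le_pow_iff_left₀ (norm_nonneg _) (norm_nonneg _) two_ne_zero).1 ?_
        have := hpyth z s₀ hs₀
        have h := sq_nonneg ‖s₀ - π z‖
        linarith
      have h2 : ‖z.2 - s₀‖ ≤ D + η z := by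
        calc ‖z.2 - s₀‖ = ‖(z.2 - z₀.2) + (z₀.2 - π z₀) - (s₀ - π z₀)‖ := by congr 1; abel
          _ ≤ ‖z.2 - z₀.2‖ + ‖z₀.2 - π z₀‖ + ‖s₀ - π z₀‖ :=
            (norm_sub_le _ _).trans (add_le_add_left (norm_add_le _ _) _)
          _ ≤ D + η z := by
            simp only [D, η, dist_eq_norm] at hs₀d ⊢
            linarith
      have h3 : ‖z₀.2 - s‖ ≤ D + 2 * η z := by
        calc ‖z₀.2 - s‖ = ‖(z.2 - π z) - (z.2 - z₀.2) - (s - π z)‖ := by congr 1; abel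
          _ ≤ ‖z.2 - π z‖ + ‖z.2 - z₀.2‖ + ‖s - π z‖ :=
            (norm_sub_le _ _).trans (add_le_add_left (norm_sub_le _ _) _)
          _ ≤ D + 2 * η z := by
            simp only [η, dist_eq_norm] at hsd h2 ⊢
            linarith
      have h4 : ‖s - π z₀‖ ≤ Real.sqrt (4 * η z * D + 4 * η z ^ 2) := by
        refine Real.le_sqrt_of_sq_le ?_
        have h5 := hpyth z₀ s hs
        have h6 : ‖z₀.2 - s‖ ^ 2 ≤ (D + 2 * η z) ^ 2 := pow_le_pow_left₀ (norm_nonneg _) h3 2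
        change D ^ 2 + _ ≤ _ at h5
        linarith
      calc ‖π z - π z₀‖ = ‖(s - π z₀) - (s - π z)‖ := by congr 1; abel
        _ ≤ ‖s - π z₀‖ + ‖s - π z‖ := norm_sub_le _ _
        _ ≤ _ := by
          have : dist z₀.1 z.1 ≤ η z := le_add_of_nonneg_right dist_nonneg
          linarith
    have hη : Continuous η := by fun_prop
    have hη0 : η z₀ = 0 := by simp [η]
    have hlim : Filter.Tendsto (fun z => η z + Real.sqrt (4 * η z * D + 4 * η z ^ 2))
        (nhds z₀) (nhds 0) := by
      have hc : Continuous fun z => η z + Real.sqrt (4 * η z * D + 4 * η z ^ 2) := by fun_prop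
      simpa [hη0] using hc.tendsto z₀
    exact tendsto_iff_norm_sub_tendsto_zero.2 (squeeze_zero (fun _ => norm_nonneg _) hbound hlim)
  · have h := hpyth (v, y) y hy
    simp only [sub_self, norm_zero] at h
    have h1 : ‖y - π (v, y)‖ = 0 := by nlinarith [norm_nonneg (y - π (v, y))]
    exact (sub_eq_zero.1 (norm_eq_zero.1 h1)).symm

theorem exists_continuous_retraction_convexHull (J K : Type*) [Fintype J] [Nonempty J] [Fintype K] :
    ∃ π : (J → K → ℝ) × (K → ℝ) → K → ℝ, Continuous π ∧
      (∀ v y, π (v, y) ∈ convexHull ℝ (range v)) ∧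
      ∀ v, ∀ y ∈ convexHull ℝ (range v), π (v, y) = y := by
  obtain ⟨π, hc, hmem, hfix⟩ := exists_continuous_nearestPoint (EuclideanSpace ℝ K) J
  let e : EuclideanSpace ℝ K ≃L[ℝ] (K → ℝ) := EuclideanSpace.equiv K ℝ
  have hhull : ∀ v : J → K → ℝ,
      e '' convexHull ℝ (range fun j => e.symm (v j)) = convexHull ℝ (range v) := by
    intro v
    have := LinearMap.image_convexHull (e : EuclideanSpace ℝ K →ₗ[ℝ] (K → ℝ))
      (range fun j => e.symm (v j))
    refine this.trans ?_
    rw [← range_comp]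
    congr 2
  refine ⟨fun z => e (π (fun j => e.symm (z.1 j), e.symm z.2)), ?_, fun v y => ?_, fun v y hy => ?_⟩
  · exact e.continuous.comp (hc.comp (by fun_prop))
  · rw [← hhull]
    exact mem_image_of_mem _ (hmem _ _)
  · rw [← hhull] at hy
    obtain ⟨u, hu, rfl⟩ := hy
    change e (π (_, e.symm (e u))) = e u
    rw [e.symm_apply_apply, hfix _ _ hu]

end NearestPoint

/-! ### Problems that are solved by parallel divisions -/

section ParDiv

open Set Topology

/-- The problem of finding an element of `R x` is solved by finitely many robust divisions of real
numbers, carried out in parallel: the dividends `num x i` and divisors `den x i` depend continuously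
on `x`, and `out` turns any quotients `q i` in `[0, 1]` into a solution. A quotient with divisor `0`
is arbitrary. -/
def ParDiv {X Y : Type} [TopologicalSpace X] [TopologicalSpace Y] (R : X → Set Y) : Prop :=
  ∃ (ι : Type) (_ : Fintype ι) (num den : X → ι → ℝ) (out : (ι → ℝ) → Y),
    Continuous num ∧ Continuous den ∧ Continuous out ∧
    (∀ x i, 0 ≤ num x i ∧ num x i ≤ den x i) ∧
    ∀ x q, (∀ i, q i ∈ Icc (0 : ℝ) 1 ∧ q i * den x i = num x i) → out q ∈ R x

namespace ParDiv

variable {X X' Y Y' : Type} [TopologicalSpace X] [TopologicalSpace X'] [TopologicalSpace Y]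
  [TopologicalSpace Y']

theorem mono {R R' : X → Set Y} (h : ParDiv R) (hR : ∀ x, R x ⊆ R' x) : ParDiv R' := by
  obtain ⟨ι, hι, num, den, out, h1, h2, h3, h4, h5⟩ := h
  exact ⟨ι, hι, num, den, out, h1, h2, h3, h4, fun x q hq => hR x (h5 x q hq)⟩

theorem comp {R : X → Set Y} (h : ParDiv R) {f : X' → X} (hf : Continuous f) :
    ParDiv fun x => R (f x) := by
  obtain ⟨ι, hι, num, den, out, h1, h2, h3, h4, h5⟩ := h
  exact ⟨ι, hι, num ∘ f, den ∘ f, out, h1.comp hf, h2.comp hf, h3, fun x => h4 (f x),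
    fun x => h5 (f x)⟩

theorem map {R : X → Set Y} (h : ParDiv R) {f : Y → Y'} (hf : Continuous f) :
    ParDiv fun x => f '' R x := by
  obtain ⟨ι, hι, num, den, out, h1, h2, h3, h4, h5⟩ := h
  exact ⟨ι, hι, num, den, f ∘ out, h1, h2, hf.comp h3, h4,
    fun x q hq => mem_image_of_mem f (h5 x q hq)⟩

theorem pi {S : Type} [Fintype S] {Z : S → Type} [∀ s, TopologicalSpace (Z s)]
    {R : ∀ s, X → Set (Z s)} (h : ∀ s, ParDiv (R s)) :
    ParDiv fun x => {y : ∀ s, Z s | ∀ s, y s ∈ R s x} := by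
  choose ι hι num den out h1 h2 h3 h4 h5 using h
  refine ⟨Σ s, ι s, inferInstance, fun x i => num i.1 x i.2, fun x i => den i.1 x i.2,
    fun q s => out s fun i => q ⟨s, i⟩, ?_, ?_, ?_, fun x i => h4 i.1 x i.2,
    fun x q hq s => h5 s x _ fun i => hq ⟨s, i⟩⟩
  · exact continuous_pi fun i => (continuous_apply i.2).comp (h1 i.1)
  · exact continuous_pi fun i => (continuous_apply i.2).comp (h2 i.1)
  · exact continuous_pi fun s => (h3 s).comp (by fun_prop)

theorem prod {R : X → Set Y} {R' : X → Set Y'} (h : ParDiv R) (h' : ParDiv R') :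
    ParDiv fun x => R x ×ˢ R' x := by
  obtain ⟨ι, hι, num, den, out, h1, h2, h3, h4, h5⟩ := h
  obtain ⟨ι', _, num', den', out', h1', h2', h3', h4', h5'⟩ := h'
  refine ⟨ι ⊕ ι', inferInstance, fun x => Sum.elim (num x) (num' x),
    fun x => Sum.elim (den x) (den' x),
    fun q => (out fun i => q (Sum.inl i), out' fun i => q (Sum.inr i)), ?_, ?_, ?_, ?_,
    fun x q hq => ⟨h5 x _ fun i => hq (Sum.inl i), h5' x _ fun i => hq (Sum.inr i)⟩⟩
  · refine continuous_pi ?_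
    rintro (i | i)
    exacts [(continuous_apply i).comp h1, (continuous_apply i).comp h1']
  · refine continuous_pi ?_
    rintro (i | i)
    exacts [(continuous_apply i).comp h2, (continuous_apply i).comp h2']
  · exact (h3.comp (by fun_prop)).prodMk (h3'.comp (by fun_prop))
  · rintro x (i | i)
    exacts [h4 x i, h4' x i]

theorem of_div {num den : X → ℝ} (h1 : Continuous num) (h2 : Continuous den)
    (h : ∀ x, 0 ≤ num x ∧ num x ≤ den x) :
    ParDiv fun x => {q : ℝ | q ∈ Icc (0 : ℝ) 1 ∧ q * den x = num x} :=
  ⟨Unit, inferInstance, fun x _ => num x, fun x _ => den x, fun q => q (), by fun_prop, by fun_prop,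
    by fun_prop, fun x _ => h x, fun _ _ hq => hq ()⟩

end ParDiv

theorem IsOpen.exists_continuous_pos_iff {X : Type} [PseudoMetricSpace X] {U : Set X}
    (hU : IsOpen U) : ∃ d : X → ℝ, Continuous d ∧ (∀ x, 0 ≤ d x) ∧ ∀ x, 0 < d x ↔ x ∈ U := by
  rcases (Uᶜ).eq_empty_or_nonempty with h | h
  · exact ⟨fun _ => 1, continuous_const, fun _ => zero_le_one,
      fun x => by simp [compl_empty_iff.1 h]⟩
  · refine ⟨fun x => Metric.infDist x Uᶜ, Metric.continuous_infDist_pt _,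
      fun _ => Metric.infDist_nonneg, fun x => ?_⟩
    rw [← hU.isClosed_compl.notMem_iff_infDist_pos h, notMem_compl_iff]

/-- One division evaluates a function with values in `[0, 1]` that is continuous on an open set `U`:
divide `d x * f x` by `d x`, where `d` is the distance from the complement of `U`. Outside `U` the
outcome is arbitrary. -/
theorem parDiv_of_continuousOn {X : Type} [PseudoMetricSpace X] {U : Set X} (hU : IsOpen U)
    {f : X → ℝ} (hf : ContinuousOn f U) (h01 : ∀ x ∈ U, f x ∈ Icc (0 : ℝ) 1) :
    ParDiv fun x => {y : ℝ | y ∈ Icc (0 : ℝ) 1 ∧ (x ∈ U → y = f x)} := by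
  classical
  obtain ⟨d, hd, hd0, hdU⟩ := hU.exists_continuous_pos_iff
  let num : X → ℝ := U.indicator fun x => f x * d x
  have hnum : ∀ x, 0 ≤ num x ∧ num x ≤ d x := by
    intro x
    by_cases hx : x ∈ U
    · simp only [num, indicator_of_mem hx]
      exact ⟨mul_nonneg (h01 x hx).1 (hd0 x), mul_le_of_le_one_left (hd0 x) (h01 x hx).2⟩
    · simp only [num, indicator_of_notMem hx]
      exact ⟨le_rfl, hd0 x⟩
  have hc : Continuous num := by
    rw [continuous_iff_continuousAt]
    intro x
    by_cases hx : x ∈ U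
    · refine ((hf.continuousAt (hU.mem_nhds hx)).mul hd.continuousAt).congr ?_
      filter_upwards [hU.mem_nhds hx] with y hy
      exact (indicator_of_mem hy (fun x => f x * d x)).symm
    · have hdx : d x = 0 := le_antisymm (not_lt.1 fun h => hx ((hdU x).1 h)) (hd0 x)
      have h0 : num x = 0 := indicator_of_notMem hx _
      rw [ContinuousAt, h0]
      exact squeeze_zero (fun y => (hnum y).1) (fun y => (hnum y).2) (hdx ▸ hd.tendsto x)
  refine (ParDiv.of_div hc hd hnum).mono fun x q hq => ⟨hq.1, fun hx => ?_⟩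
  have h : q * d x = f x * d x := hq.2.trans (indicator_of_mem hx _)
  exact mul_right_cancel₀ ((hdU x).2 hx).ne' h

/-- A deviation `δ` that vanishes over a closed set `C` has a continuous bound, independent of the
second argument, that vanishes on `C` as well. -/
theorem exists_continuous_bound_of_eq_zero {X V : Type} [PseudoMetricSpace X] [TopologicalSpace V]
    {P : X → Set V} (hP : IsClosed {z : X × V | z.2 ∈ P z.1}) {K : Set V} (hK : IsCompact K)
    (hPK : ∀ x, P x ⊆ K) {δ : X × V → ℝ} (hδ : Continuous δ) (hδ1 : ∀ x, ∀ y ∈ P x, δ (x, y) ≤ 1)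
    {C : Set X} (hC : IsClosed C) (h0 : ∀ x ∈ C, ∀ y ∈ P x, δ (x, y) = 0) :
    ∃ ε : X → ℝ, Continuous ε ∧ (∀ x, ε x ∈ Icc (0 : ℝ) 1) ∧ (∀ x ∈ C, ε x = 0) ∧
      ∀ x, ∀ y ∈ P x, δ (x, y) ≤ ε x := by
  have : CompactSpace K := isCompact_iff_compactSpace.1 hK
  let B : ℕ → Set X := fun k =>
    Prod.fst '' {z : X × K | (z.2 : V) ∈ P z.1 ∧ (1 / 2 : ℝ) ^ k ≤ δ (z.1, z.2)}
  have hB : ∀ k, IsClosed (B k) := fun k => isClosedMap_fst_of_compactSpace _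
    ((hP.preimage (f := fun z : X × K => (z.1, (z.2 : V))) (by fun_prop)).inter
      (isClosed_le (f := fun _ => (1 / 2 : ℝ) ^ k) (g := fun z : X × K => δ (z.1, z.2))
        continuous_const (by fun_prop)))
  have hdisj : ∀ k, Disjoint C (B k) := by
    intro k
    rw [Set.disjoint_left]
    rintro _ hx ⟨z, ⟨hz, hzk⟩, rfl⟩
    rw [h0 _ hx _ hz] at hzk
    exact absurd hzk (not_le.2 (by positivity))
  choose φ hφ0 hφ1 hφ using fun k => exists_continuous_zero_one_of_isClosed hC (hB k) (hdisj k)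
  have hle : ∀ k x, ‖2 * (1 / 2 : ℝ) ^ k * φ k x‖ ≤ 2 * (1 / 2 : ℝ) ^ k := by
    intro k x
    have h1 := (hφ k x).1
    rw [Real.norm_of_nonneg (by positivity)]
    exact mul_le_of_le_one_right (by positivity) (hφ k x).2
  have hsum : Summable fun k : ℕ => 2 * (1 / 2 : ℝ) ^ k := summable_geometric_two.mul_left 2
  have hsummable : ∀ x, Summable fun k => 2 * (1 / 2 : ℝ) ^ k * φ k x := fun x =>
    Summable.of_norm_bounded hsum fun k => hle k x
  have hterm : ∀ k x, 0 ≤ 2 * (1 / 2 : ℝ) ^ k * φ k x := fun k x => by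
    have h1 := (hφ k x).1
    positivity
  refine ⟨fun x => min 1 (∑' k, 2 * (1 / 2 : ℝ) ^ k * φ k x), ?_, fun x => ⟨?_, min_le_left _ _⟩,
    fun x hx => ?_, fun x y hy => ?_⟩
  · exact continuous_const.min (continuous_tsum (fun k => by fun_prop) hsum hle)
  · exact le_min zero_le_one (tsum_nonneg fun k => hterm k x)
  · have h : ∀ k, 2 * (1 / 2 : ℝ) ^ k * φ k x = 0 := fun k => by
      rw [hφ0 k hx, Pi.zero_apply, mul_zero]
    simp only [h, tsum_zero]
    exact min_eq_right zero_le_one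
  · refine le_min (hδ1 x y hy) ?_
    rcases le_or_gt (δ (x, y)) 0 with hneg | hpos
    · exact hneg.trans (tsum_nonneg fun k => hterm k x)
    have hk : ∃ k : ℕ, (1 / 2 : ℝ) ^ k ≤ δ (x, y) :=
      (exists_pow_lt_of_lt_one hpos (by norm_num)).imp fun _ => le_of_lt
    classical
    -- The first `k` with `2⁻ᵏ ≤ δ` gives a summand that is at least `δ`.
    have hspec := Nat.find_spec hk
    have hφk : φ (Nat.find hk) x = 1 :=
      hφ1 _ ⟨(x, ⟨y, hPK x hy⟩), ⟨hy, hspec⟩, rfl⟩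
    have hbig : δ (x, y) ≤ 2 * (1 / 2 : ℝ) ^ Nat.find hk := by
      rcases Nat.eq_zero_or_pos (Nat.find hk) with h | h
      · rw [h, pow_zero]
        linarith [hδ1 x y hy]
      · have hmin := Nat.find_min hk (Nat.sub_lt h one_pos)
        have hpow : (1 / 2 : ℝ) ^ Nat.find hk = (1 / 2) ^ (Nat.find hk - 1) * (1 / 2) := by
          rw [← pow_succ, Nat.sub_add_cancel h]
        rw [hpow]
        linarith [not_le.1 hmin]
    calc δ (x, y) ≤ 2 * (1 / 2 : ℝ) ^ Nat.find hk * φ (Nat.find hk) x := by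
          rw [hφk, mul_one]; exact hbig
      _ ≤ _ := (hsummable x).le_tsum _ fun k _ => hterm k x

/-- The point `y`, moved into the box of radius `ε` about the point `π (v, y)`, where `θ = (v, ε)`. -/
def moveNear {J K : Type} (π : (J → K → ℝ) × (K → ℝ) → K → ℝ) (θ : (J → K → ℝ) × ℝ) (y : K → ℝ) :
    K → ℝ :=
  fun i => max (π (θ.1, y) i - θ.2) (min (π (θ.1, y) i + θ.2) (y i))

/-- Let `P x` be the convex hull of the points `h x j` for `x` in the relatively closed subset
`U ∩ C` of the open set `U`. Parallel divisions yield a map of the form `moveNear π θ` that fixes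
`P x` for `x ∈ U`, and that maps everything into `P x` for `x ∈ U ∩ C`. -/
theorem parDiv_moveNear {X J K : Type} [PseudoMetricSpace X] [Fintype J] [Fintype K]
    {π : (J → K → ℝ) × (K → ℝ) → K → ℝ} (hπ : Continuous π)
    (hmem : ∀ v y, π (v, y) ∈ convexHull ℝ (range v))
    (hfix : ∀ v, ∀ y ∈ convexHull ℝ (range v), π (v, y) = y)
    {P : X → Set (K → ℝ)} (hP : IsClosed {z : X × (K → ℝ) | z.2 ∈ P z.1})
    (hP1 : ∀ x, P x ⊆ Icc 0 1) {U C : Set X} (hU : IsOpen U) (hC : IsClosed C)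
    {h : X → J → K → ℝ} (hh : ContinuousOn h (U ∩ C)) (hh1 : ∀ x ∈ U ∩ C, ∀ j, h x j ∈ Icc 0 1)
    (hhull : ∀ x ∈ U ∩ C, (P x).Nonempty → convexHull ℝ (range (h x)) = P x) :
    ParDiv fun x => {θ : (J → K → ℝ) × ℝ | x ∈ U → (∀ y ∈ P x, moveNear π θ y = y) ∧
      (x ∈ C → (P x).Nonempty → ∀ y, moveNear π θ y ∈ P x)} := by
  classical
  let C' : Set U := Subtype.val ⁻¹' C
  have hC' : IsClosed C' := hC.preimage continuous_subtype_val
  have hmaps : ∀ x : C', ((x : U) : X) ∈ U ∩ C := fun x => ⟨x.1.2, x.2⟩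
  have hhc : Continuous fun x : C' => h x.1.1 :=
    hh.comp_continuous (by fun_prop) hmaps
  have hext : ∀ (j : J) (i : K), ∃ g : C(U, ℝ), (∀ x, g x ∈ Icc (0 : ℝ) 1) ∧
      ∀ x ∈ C', g x = h x j i := by
    intro j i
    obtain ⟨g, hg, hgr⟩ := ContinuousMap.exists_restrict_eq_forall_mem_of_closed
      (⟨fun x : C' => h x.1.1 j i, (continuous_apply_apply j i).comp hhc⟩ : C(C', ℝ)) (t := Icc 0 1)
      (fun x => ⟨(hh1 _ (hmaps x) j).1 i, (hh1 _ (hmaps x) j).2 i⟩) ⟨0, by simp⟩ hC'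
    exact ⟨g, hg, fun x hx => DFunLike.congr_fun hgr ⟨x, hx⟩⟩
  choose g hg hgC using hext
  let v : U → J → K → ℝ := fun x j i => g j i x
  have hv : Continuous v := by fun_prop
  have hvC : ∀ x ∈ C', v x = h x := fun x hx => by
    funext j i
    exact hgC j i x hx
  have hvhull : ∀ x y, π (v x, y) ∈ Icc (0 : K → ℝ) 1 := fun x y =>
    convexHull_min (by
      rintro _ ⟨j, rfl⟩
      exact ⟨fun i => (hg j i x).1, fun i => (hg j i x).2⟩) (convex_Icc _ _) (hmem (v x) y)
  obtain ⟨ε, hε, hε1, hε0, hεδ⟩ := exists_continuous_bound_of_eq_zero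
    (P := fun x : U => P x) (hP.preimage (f := fun z : U × (K → ℝ) => ((z.1 : X), z.2)) (by fun_prop))
    (isCompact_Icc (a := (0 : K → ℝ)) (b := 1)) (fun x => hP1 x)
    (δ := fun z => dist z.2 (π (v z.1, z.2))) (by fun_prop) (by
      intro x y hy
      refine (dist_pi_le_iff zero_le_one).2 fun i => ?_
      have h1 := hP1 x hy
      have h2 := hvhull x y
      rw [Real.dist_eq, abs_le]
      have h3 := h1.1 i
      have h4 := h1.2 i
      have h5 := h2.1 i
      have h6 := h2.2 i
      simp only [Pi.zero_apply, Pi.one_apply] at h3 h4 h5 h6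
      constructor <;> linarith) hC' (by
      intro x hx y hy
      have h1 : y ∈ convexHull ℝ (range (v x)) := by
        rw [hvC x hx, hhull x ⟨x.2, hx⟩ ⟨y, hy⟩]
        exact hy
      simp [hfix _ _ h1])
  have hdiv : ∀ f : U → ℝ, Continuous f → (∀ x, f x ∈ Icc (0 : ℝ) 1) →
      ParDiv fun x => {y : ℝ | y ∈ Icc (0 : ℝ) 1 ∧
        (x ∈ U → y = if hx : x ∈ U then f ⟨x, hx⟩ else 0)} := by
    intro f hf hf1
    refine parDiv_of_continuousOn hU ?_ fun x hx => by simpa [hx] using hf1 ⟨x, hx⟩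
    rw [continuousOn_iff_continuous_domRestrict]
    refine hf.congr fun x => ?_
    simp
  refine ((ParDiv.pi fun j => ParDiv.pi fun i => hdiv _ (g j i).continuous (hg j i)).prod
    (hdiv ε hε hε1)).mono ?_
  rintro x ⟨v', ε'⟩ ⟨hv', hε'⟩ hx
  have hv'x : v' = v ⟨x, hx⟩ := by
    funext j i
    simpa [hx] using (hv' j i).2 hx
  have hε'x : ε' = ε ⟨x, hx⟩ := by simpa [hx] using hε'.2 hx
  subst hv'x hε'x
  refine ⟨fun y hy => funext fun i => ?_, fun hxC hne y => ?_⟩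
  · have h1 := (dist_le_pi_dist y (π (v ⟨x, hx⟩, y)) i).trans (hεδ ⟨x, hx⟩ y hy)
    rw [Real.dist_eq, abs_le] at h1
    simp only [moveNear]
    rw [min_eq_right (by linarith), max_eq_right (by linarith)]
  · have h1 : moveNear π (v ⟨x, hx⟩, ε ⟨x, hx⟩) y = π (v ⟨x, hx⟩, y) := by
      funext i
      simp only [moveNear, hε0 ⟨x, hx⟩ hxC, sub_zero, add_zero]
      exact max_eq_left (min_le_left _ _)
    rw [h1, ← hhull x ⟨hx, hxC⟩ hne, ← hvC ⟨x, hx⟩ hxC]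
    exact hmem _ _

end ParDiv

/-! ### Polytopes whose vertices depend continuously on parameters -/

section Candidates

open Set Topology

variable {X J K : Type}

open scoped Classical in
/-- The candidates for vertices that are defined at `x` and belong to `P x`. They need not
be distinct or extreme. -/
noncomputable def activeVertices [Fintype J] (P : X → Set (K → ℝ)) (U : J → Set X) (v : J → X → K → ℝ) (x : X) :
    Finset J :=
  Finset.univ.filter fun j => x ∈ U j ∧ v j x ∈ P x

open scoped Classical in
/-- The index of the stratum of `x`. It depends on the number of candidates that are undefined at
`x`, and for points that agree in this number, on the number of active vertices. -/
noncomputable def stratum [Fintype J] (P : X → Set (K → ℝ)) (U : J → Set X) (v : J → X → K → ℝ) (x : X) : ℕ :=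
  (Fintype.card J + 1) * (Finset.univ.filter fun j => x ∉ U j).card + (activeVertices P U v x).card

theorem stratum_le [Fintype J] (P : X → Set (K → ℝ)) (U : J → Set X) (v : J → X → K → ℝ) (x : X) :
    stratum P U v x ≤ (Fintype.card J + 1) * Fintype.card J + Fintype.card J :=
  add_le_add (Nat.mul_le_mul_left _ (Finset.card_le_univ _)) (Finset.card_le_univ _)

/-- The stratum is upper semicontinuous, and the set of active vertices is locally constant on each
stratum: in a neighbourhood, no candidate becomes undefined, and if none becomes defined either, then
no vertex becomes active. -/
theorem eventually_stratum_le [TopologicalSpace X] [Fintype J] {P : X → Set (K → ℝ)}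
    (hP : IsClosed {z : X × (K → ℝ) | z.2 ∈ P z.1}) {U : J → Set X} (hU : ∀ j, IsOpen (U j))
    {v : J → X → K → ℝ} (hv : ∀ j, ContinuousOn (v j) (U j)) (x : X) :
    ∀ᶠ y in 𝓝 x, stratum P U v y ≤ stratum P U v x ∧
      (stratum P U v y = stratum P U v x → activeVertices P U v y = activeVertices P U v x) := by
  classical
  have h1 : ∀ᶠ y in 𝓝 x, ∀ j, x ∈ U j → y ∈ U j := by
    rw [Filter.eventually_all]
    intro j
    by_cases hx : x ∈ U j
    · filter_upwards [(hU j).mem_nhds hx] with y hy _ using hy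
    · exact Filter.Eventually.of_forall fun y h => absurd h hx
  have h2 : ∀ᶠ y in 𝓝 x, ∀ j, x ∈ U j → v j x ∉ P x → v j y ∉ P y := by
    rw [Filter.eventually_all]
    intro j
    by_cases hx : x ∈ U j ∧ v j x ∉ P x
    · have hc : ContinuousAt (fun y => (y, v j y)) x :=
        continuousAt_id.prodMk ((hv j).continuousAt ((hU j).mem_nhds hx.1))
      exact (hc.eventually (hP.isOpen_compl.mem_nhds (show (x, v j x) ∈ _ from hx.2))).mono
        fun y hy _ _ => hy
    · exact Filter.Eventually.of_forall fun y h h' => absurd ⟨h, h'⟩ hx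
  filter_upwards [h1, h2] with y hy1 hy2
  have hsub : (Finset.univ.filter fun j => y ∉ U j) ⊆ Finset.univ.filter fun j => x ∉ U j :=
    Finset.monotone_filter_right _ fun j _ hj hx => hj (hy1 j hx)
  rcases hsub.eq_or_ssubset with heq | hlt
  · have hW : activeVertices P U v y ⊆ activeVertices P U v x := by
      intro j hj
      simp only [activeVertices, Finset.mem_filter, Finset.mem_univ, true_and] at hj ⊢
      have hx : x ∈ U j := by
        by_contra hx
        have : j ∈ Finset.univ.filter fun j => y ∉ U j := by rw [heq]; simpa using hx
        exact (Finset.mem_filter.1 this).2 hj.1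
      exact ⟨hx, by_contra fun h => hy2 j hx h hj.2⟩
    refine ⟨?_, fun h => Finset.eq_of_subset_of_card_le hW ?_⟩
    · rw [stratum, stratum, heq]
      exact Nat.add_le_add_left (Finset.card_le_card hW) _
    · rw [stratum, stratum, heq] at h
      exact (Nat.add_left_cancel h).ge
  · have hcard := Finset.card_lt_card hlt
    have hWy : (activeVertices P U v y).card ≤ Fintype.card J := Finset.card_le_univ _
    have hlt' : stratum P U v y < stratum P U v x := by
      have := Nat.mul_le_mul_left (Fintype.card J + 1) hcard
      simp only [stratum]
      rw [Nat.succ_eq_add_one, mul_add] at this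
      omega
    exact ⟨hlt'.le, fun h => absurd h hlt'.ne⟩

open scoped Classical in
/-- The candidates `v j x` with `j ∈ W`, where the others are replaced by one of these. -/
noncomputable def fillVertices (v : J → X → K → ℝ) (W : Finset J) (x : X) : J → K → ℝ := fun j =>
  if j ∈ W then v j x else if h : W.Nonempty then v h.choose x else 0

theorem range_fillVertices (v : J → X → K → ℝ) {W : Finset J} (hW : W.Nonempty) (x : X) :
    range (fillVertices v W x) = {p | ∃ j ∈ W, v j x = p} := by
  ext p
  constructor
  · rintro ⟨j, rfl⟩
    by_cases hj : j ∈ W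
    · exact ⟨j, hj, by simp [fillVertices, hj]⟩
    · exact ⟨hW.choose, hW.choose_spec, by simp [fillVertices, hj, hW]⟩
  · rintro ⟨j, hj, rfl⟩
    exact ⟨j, by simp [fillVertices, hj]⟩

theorem continuousAt_fillVertices [TopologicalSpace X] {v : J → X → K → ℝ} {W : Finset J} {x : X}
    (h : ∀ j ∈ W, ContinuousAt (v j) x) : ContinuousAt (fillVertices v W) x := by
  refine continuousAt_pi.2 fun j => ?_
  by_cases hj : j ∈ W
  · simpa [fillVertices, hj] using h j hj
  · by_cases hW : W.Nonempty
    · simpa [fillVertices, hj, hW] using h _ hW.choose_spec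
    · simpa [fillVertices, hj, hW] using continuousAt_const

theorem continuous_moveNear {π : (J → K → ℝ) × (K → ℝ) → K → ℝ} (hπ : Continuous π) :
    Continuous fun z : ((J → K → ℝ) × ℝ) × (K → ℝ) => moveNear π z.1 z.2 := by
  unfold moveNear
  fun_prop

/-- The result of applying the first `k` of the maps `moveNear π (θ s)` in succession. -/
noncomputable def moveChain (π : (J → K → ℝ) × (K → ℝ) → K → ℝ) {S : ℕ}
    (θ : Fin S → (J → K → ℝ) × ℝ) : ℕ → K → ℝ
  | 0 => 0
  | k + 1 => if h : k < S then moveNear π (θ ⟨k, h⟩) (moveChain π θ k) else moveChain π θ k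

theorem continuous_moveChain {π : (J → K → ℝ) × (K → ℝ) → K → ℝ} (hπ : Continuous π)
    {S : ℕ} (k : ℕ) : Continuous fun θ : Fin S → (J → K → ℝ) × ℝ => moveChain π θ k := by
  induction k with
  | zero => exact continuous_const
  | succ k ih =>
    by_cases h : k < S
    · simp only [moveChain, h, dite_true]
      exact (continuous_moveNear hπ).comp ((continuous_apply _).prodMk ih)
    · simpa only [moveChain, h, dite_false] using ih

/-- Let `P x` be a polytope with closed graph whose vertices are among the points `v j x`, each of
them defined and continuous on an open set. Then an element of `P x` is found by parallel divisions.

The stratum with index `s` is relatively closed in the open set of points with stratum at most `s`, and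
on it the vertices are continuous. Hence there are parallel divisions that yield maps, one for every
`s`, such that at a point `x` with stratum `s` the map for `s` sends everything into `P x`, and the
later ones fix `P x`. Nothing is known about the earlier ones, but this does not matter for the
composition of all of them. -/
theorem parDiv_of_vertices [PseudoMetricSpace X] [Fintype J] [Nonempty J] [Fintype K] {P : X → Set (K → ℝ)}
    (hP : IsClosed {z : X × (K → ℝ) | z.2 ∈ P z.1}) (hP1 : ∀ x, P x ⊆ Icc 0 1)
    {U : J → Set X} (hU : ∀ j, IsOpen (U j)) {v : J → X → K → ℝ}
    (hv : ∀ j, ContinuousOn (v j) (U j))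
    (hhull : ∀ x, P x = convexHull ℝ {p | ∃ j, (x ∈ U j ∧ v j x ∈ P x) ∧ v j x = p}) :
    ParDiv fun x => {y : K → ℝ | (P x).Nonempty → y ∈ P x} := by
  classical
  obtain ⟨π, hπ, hmem, hfix⟩ := exists_continuous_retraction_convexHull J K
  let r : X → ℕ := stratum P U v
  have hr := eventually_stratum_le hP hU hv
  have hopen : ∀ s, IsOpen {x | r x ≤ s} := fun s => isOpen_iff_mem_nhds.2 fun x hx =>
    (hr x).mono fun y hy => hy.1.trans hx
  have hclosed : ∀ s, IsClosed {x | s ≤ r x} := fun s => by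
    refine ⟨isOpen_iff_mem_nhds.2 fun x hx => (hr x).mono fun y hy => ?_⟩
    simp only [mem_compl_iff, mem_ofPred_eq, not_le] at hx ⊢
    exact hy.1.trans_lt hx
  have hactive : ∀ x, (P x).Nonempty → (activeVertices P U v x).Nonempty := by
    intro x hx
    rw [hhull x, convexHull_nonempty_iff] at hx
    obtain ⟨_, j, hj, -⟩ := hx
    exact ⟨j, by simpa [activeVertices] using hj⟩
  have hstage := fun s : ℕ => parDiv_moveNear hπ hmem hfix hP hP1 (hopen s) (hclosed s)
    (h := fun x => fillVertices v (activeVertices P U v x) x) (by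
      rintro x ⟨hx1, hx2⟩
      refine ContinuousAt.continuousWithinAt (continuousAt_fillVertices
        (W := activeVertices P U v x) fun j hj => ?_) |>.congr_of_eventuallyEq ?_ rfl
      · exact (hv j).continuousAt ((hU j).mem_nhds (Finset.mem_filter.1 hj).2.1)
      · filter_upwards [nhdsWithin_le_nhds (hr x), self_mem_nhdsWithin] with y hy hys
        rw [hy.2 ((le_antisymm hys.1 hys.2).trans (le_antisymm hx1 hx2).symm)])
    (by
      rintro x - j
      simp only [fillVertices]
      split_ifs with h1 h2
      · exact hP1 x (Finset.mem_filter.1 h1).2.2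
      · exact hP1 x (Finset.mem_filter.1 h2.choose_spec).2.2
      · exact ⟨le_rfl, zero_le_one⟩)
    (by
      rintro x - hx
      rw [range_fillVertices v (hactive x hx)]
      conv_rhs => rw [hhull x]
      simp [activeVertices])
  set S := (Fintype.card J + 1) * Fintype.card J + Fintype.card J with hS
  refine ((ParDiv.pi fun s : Fin (S + 1) => hstage s).map
    (continuous_moveChain hπ (S + 1))).mono ?_
  rintro x _ ⟨θ, hθ, rfl⟩ hne
  have key : ∀ k, r x < k → k ≤ S + 1 → moveChain π θ k ∈ P x := by
    intro k
    induction k with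
    | zero => intro h; exact absurd h (Nat.not_lt_zero _)
    | succ k ih =>
      intro h1 h2
      have hk : k < S + 1 := h2
      obtain ⟨hfixP, hinto⟩ := hθ ⟨k, hk⟩ (Nat.le_of_lt_succ h1)
      simp only [moveChain, hk, dite_true]
      rcases (Nat.le_of_lt_succ h1).eq_or_lt with h | h
      · exact hinto h.ge hne _
      · rw [hfixP _ (ih h hk.le)]
        exact ih h hk.le
  exact key (S + 1) (Nat.lt_succ_of_le (stratum_le P U v x)) le_rfl

end Candidates

/-! ### Solving systems of linear inequalities in a simplex -/

section Polytope

open Set Topology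
open scoped Matrix

variable {J K : Type} [DecidableEq J]

/-- The coefficients of the linear inequalities `0 ≤ y j` and `0 ≤ M k ⬝ᵥ y`. -/
def constraintRow (M : K → J → ℝ) : J ⊕ K → J → ℝ := Sum.elim (fun j => Pi.single j 1) M

/-- The Gram matrix of the equations `∑ j, y j = 1` and `constraintRow M c ⬝ᵥ y = 0` for `c ∈ T`. -/
def constraintGram (M : K → J → ℝ) (T : Finset (J ⊕ K)) : Matrix J J ℝ :=
  Matrix.of fun i j => 1 + ∑ c ∈ T, constraintRow M c i * constraintRow M c j

theorem continuous_constraintGram (T : Finset (J ⊕ K)) :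
    Continuous fun M : K → J → ℝ => constraintGram M T := by
  refine continuous_matrix fun i j => ?_
  simp only [constraintGram, Matrix.of_apply]
  refine continuous_const.add (continuous_finsetSum _ fun c _ => ?_)
  rcases c with j | k <;>
  · simp only [constraintRow, Sum.elim_inl, Sum.elim_inr]
    fun_prop

variable [Fintype J]

/-- The vectors `y` of the standard simplex with `0 ≤ M k ⬝ᵥ y` for every `k`. -/
def polytope (M : K → J → ℝ) : Set (J → ℝ) :=
  {y | ∑ j, y j = 1 ∧ ∀ c, 0 ≤ constraintRow M c ⬝ᵥ y}

theorem mem_polytope {M : K → J → ℝ} {y : J → ℝ} :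
    y ∈ polytope M ↔ y ∈ stdSimplex ℝ J ∧ ∀ k, 0 ≤ M k ⬝ᵥ y := by
  simp only [polytope, stdSimplex, constraintRow, mem_ofPred_eq, Sum.forall, Sum.elim_inl,
    Sum.elim_inr, single_one_dotProduct]
  tauto

theorem polytope_subset_Icc (M : K → J → ℝ) : polytope M ⊆ Icc 0 1 := by
  intro y hy
  have h := (mem_polytope.1 hy).1
  refine ⟨h.1, fun j => ?_⟩
  rw [Pi.one_apply, ← h.2]
  exact Finset.single_le_sum (fun j _ => h.1 j) (Finset.mem_univ j)

theorem isClosed_polytope_graph : IsClosed {z : (K → J → ℝ) × (J → ℝ) | z.2 ∈ polytope z.1} := by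
  have h : {z : (K → J → ℝ) × (J → ℝ) | z.2 ∈ polytope z.1} =
      {z | z.2 ∈ stdSimplex ℝ J} ∩ ⋂ k, {z | 0 ≤ z.1 k ⬝ᵥ z.2} := by
    ext z
    simp [mem_polytope]
  rw [h]
  refine ((isClosed_stdSimplex ℝ J).preimage continuous_snd).inter (isClosed_iInter fun k =>
    isClosed_le continuous_const ?_)
  unfold dotProduct
  fun_prop

theorem isClosed_polytope (M : K → J → ℝ) : IsClosed (polytope M) :=
  isClosed_polytope_graph.preimage (f := fun y : J → ℝ => (M, y)) (by fun_prop)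

theorem convex_polytope (M : K → J → ℝ) : Convex ℝ (polytope M) := by
  intro x hx y hy a b ha hb hab
  refine ⟨?_, fun c => ?_⟩
  · simp only [Pi.add_apply, Pi.smul_apply, smul_eq_mul, Finset.sum_add_distrib, ← Finset.mul_sum]
    rw [hx.1, hy.1, mul_one, mul_one, hab]
  · rw [dotProduct_add, dotProduct_smul, dotProduct_smul, smul_eq_mul, smul_eq_mul]
    exact add_nonneg (mul_nonneg ha (hx.2 c)) (mul_nonneg hb (hy.2 c))

theorem constraintGram_mulVec (M : K → J → ℝ) (T : Finset (J ⊕ K)) (y : J → ℝ) (i : J) :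
    (constraintGram M T *ᵥ y) i =
      ∑ j, y j + ∑ c ∈ T, constraintRow M c i * (constraintRow M c ⬝ᵥ y) := by
  simp only [Matrix.mulVec, dotProduct, constraintGram, Matrix.of_apply, add_mul, one_mul,
    Finset.sum_add_distrib, Finset.sum_mul, Finset.mul_sum, mul_assoc]
  rw [Finset.sum_comm]

theorem dotProduct_constraintGram_mulVec (M : K → J → ℝ) (T : Finset (J ⊕ K)) (y : J → ℝ) :
    y ⬝ᵥ (constraintGram M T *ᵥ y) =
      (∑ j, y j) ^ 2 + ∑ c ∈ T, (constraintRow M c ⬝ᵥ y) ^ 2 := by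
  calc y ⬝ᵥ (constraintGram M T *ᵥ y)
      = ∑ i, (y i * ∑ j, y j +
          ∑ c ∈ T, constraintRow M c i * y i * (constraintRow M c ⬝ᵥ y)) := by
        refine Finset.sum_congr rfl fun i _ => ?_
        rw [constraintGram_mulVec, mul_add, Finset.mul_sum T]
        congr 1
        exact Finset.sum_congr rfl fun c _ => by ring
    _ = (∑ j, y j) * (∑ j, y j) +
          ∑ c ∈ T, ∑ i, constraintRow M c i * y i * (constraintRow M c ⬝ᵥ y) := by
        rw [Finset.sum_add_distrib, ← Finset.sum_mul, Finset.sum_comm]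
    _ = _ := by
        rw [sq]
        congr 1
        refine Finset.sum_congr rfl fun c _ => ?_
        rw [← Finset.sum_mul, sq]
        rfl

/-- The only possible solution of the equations `∑ j, y j = 1` and `constraintRow M c ⬝ᵥ y = 0` for
`c ∈ T`, if their Gram matrix is invertible. -/
noncomputable def basicSolution (M : K → J → ℝ) (T : Finset (J ⊕ K)) : J → ℝ :=
  (constraintGram M T)⁻¹ *ᵥ 1

/-- A vertex is the basic solution that belongs to the set of its tight constraints: if the Gram
matrix were singular, then moving a little along a vector of its kernel would stay inside. -/
theorem exists_eq_basicSolution_of_mem_extremePoints [Fintype K] {M : K → J → ℝ} {y : J → ℝ}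
    (hy : y ∈ extremePoints ℝ (polytope M)) :
    ∃ T, (constraintGram M T).det ≠ 0 ∧ basicSolution M T = y := by
  classical
  let T : Finset (J ⊕ K) := Finset.univ.filter fun c => constraintRow M c ⬝ᵥ y = 0
  have hT : ∀ c, c ∈ T ↔ constraintRow M c ⬝ᵥ y = 0 := fun c => by simp [T]
  have hdet : (constraintGram M T).det ≠ 0 := by
    intro h0
    obtain ⟨z, hz, hGz⟩ := Matrix.exists_mulVec_eq_zero_iff.2 h0
    have hsq := dotProduct_constraintGram_mulVec M T z
    rw [hGz, dotProduct_zero] at hsq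
    have hs0 : 0 ≤ ∑ c ∈ T, (constraintRow M c ⬝ᵥ z) ^ 2 := Finset.sum_nonneg fun _ _ => sq_nonneg _
    have hsum : ∑ j, z j = 0 := by nlinarith [sq_nonneg (∑ j, z j)]
    have hrow : ∀ c ∈ T, constraintRow M c ⬝ᵥ z = 0 := by
      rw [hsum] at hsq
      intro c hc
      have := (Finset.sum_eq_zero_iff_of_nonneg fun _ _ => sq_nonneg _).1
        (show ∑ c ∈ T, (constraintRow M c ⬝ᵥ z) ^ 2 = 0 by linarith) c hc
      exact pow_eq_zero_iff two_ne_zero |>.1 this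
    have hev : ∀ᶠ ε : ℝ in 𝓝[>] 0, ∀ c, ε * |constraintRow M c ⬝ᵥ z| ≤ constraintRow M c ⬝ᵥ y := by
      rw [Filter.eventually_all]
      intro c
      by_cases hc : c ∈ T
      · exact Filter.Eventually.of_forall fun ε => by rw [hrow c hc, (hT c).1 hc]; simp
      · have hpos : 0 < constraintRow M c ⬝ᵥ y :=
          lt_of_le_of_ne (hy.1.2 c) fun h => hc ((hT c).2 h.symm)
        have hlim : Filter.Tendsto (fun ε : ℝ => ε * |constraintRow M c ⬝ᵥ z|) (𝓝[>] 0) (𝓝 0) := by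
          have : Continuous fun ε : ℝ => ε * |constraintRow M c ⬝ᵥ z| := by fun_prop
          simpa using (this.tendsto 0).mono_left nhdsWithin_le_nhds
        exact (hlim.eventually (gt_mem_nhds hpos)).mono fun ε => le_of_lt
    obtain ⟨ε, hε, hε0⟩ := (hev.and self_mem_nhdsWithin).exists
    have hmem : ∀ s : ℝ, |s| = ε → y + s • z ∈ polytope M := by
      intro s hs
      refine ⟨?_, fun c => ?_⟩
      · simp [Finset.sum_add_distrib, ← Finset.mul_sum, hsum, hy.1.1]
      · rw [dotProduct_add, dotProduct_smul, smul_eq_mul]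
        have h1 := hε c
        rw [← hs, ← abs_mul] at h1
        linarith [neg_abs_le (s * (constraintRow M c ⬝ᵥ z))]
    have hε0 : 0 < ε := hε0
    have h1 := hmem ε (abs_of_pos hε0)
    have h2 := hmem (-ε) (by rw [abs_neg, abs_of_pos hε0])
    have h3 := (mem_extremePoints.1 hy).2 _ h1 _ h2 ⟨1 / 2, 1 / 2, by norm_num, by norm_num,
      by norm_num, by module⟩
    have h4 : ε • z = 0 := by simpa using h3.1
    exact hz ((smul_eq_zero.1 h4).resolve_left hε0.ne')
  refine ⟨T, hdet, ?_⟩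
  have hG : constraintGram M T *ᵥ y = 1 := by
    funext i
    rw [constraintGram_mulVec, hy.1.1, Finset.sum_eq_zero, add_zero, Pi.one_apply]
    intro c hc
    rw [(hT c).1 hc, mul_zero]
  rw [basicSolution, ← hG, Matrix.mulVec_mulVec,
    Matrix.nonsing_inv_mul _ (isUnit_iff_ne_zero.2 hdet), Matrix.one_mulVec]

theorem polytope_eq_convexHull [Fintype K] (M : K → J → ℝ) :
    polytope M = convexHull ℝ {p | ∃ T, ((constraintGram M T).det ≠ 0 ∧
      basicSolution M T ∈ polytope M) ∧ basicSolution M T = p} := by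
  classical
  set S := {p | ∃ T, ((constraintGram M T).det ≠ 0 ∧ basicSolution M T ∈ polytope M) ∧
    basicSolution M T = p} with hS
  have hfin : S.Finite := (finite_range (basicSolution M)).subset (by
    rintro p ⟨T, -, rfl⟩
    exact mem_range_self T)
  have hcomp : IsCompact (polytope M) :=
    isCompact_Icc.of_isClosed_subset (isClosed_polytope M) (polytope_subset_Icc M)
  refine Subset.antisymm ?_ (convexHull_min ?_ (convex_polytope M))
  · rw [← closure_convexHull_extremePoints hcomp (convex_polytope M)]
    refine closure_minimal (convexHull_mono fun y hy => ?_) (hfin.isClosed_convexHull ℝ)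
    obtain ⟨T, hT, rfl⟩ := exists_eq_basicSolution_of_mem_extremePoints hy
    exact ⟨T, ⟨hT, hy.1⟩, rfl⟩
  · rintro p ⟨T, hT, rfl⟩
    exact hT.2

theorem continuousOn_basicSolution (T : Finset (J ⊕ K)) :
    ContinuousOn (fun M : K → J → ℝ => basicSolution M T) {M | (constraintGram M T).det ≠ 0} := by
  intro M hM
  have hG := continuous_constraintGram (J := J) (K := K) T
  have h1 : ContinuousAt (fun M : K → J → ℝ => (constraintGram M T)⁻¹) M := by
    simp only [Matrix.inv_def, Ring.inverse_eq_inv']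
    exact (hG.matrix_det.continuousAt.inv₀ hM).smul hG.matrix_adjugate.continuousAt
  have h2 : Continuous fun A : Matrix J J ℝ => A *ᵥ (1 : J → ℝ) :=
    continuous_id.matrix_mulVec continuous_const
  exact (h2.continuousAt.comp h1).continuousWithinAt

/-- Finding a point of a nonempty polytope in the standard simplex, given by linear inequalities. -/
theorem parDiv_polytope [Fintype K] : ParDiv fun M : K → J → ℝ =>
    {y : J → ℝ | (polytope M).Nonempty → y ∈ polytope M} :=
  parDiv_of_vertices (J := Finset (J ⊕ K)) isClosed_polytope_graph polytope_subset_Icc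
    (U := fun T => {M | (constraintGram M T).det ≠ 0})
    (fun T => isOpen_ne_fun (continuous_constraintGram T).matrix_det continuous_const)
    (v := fun T M => basicSolution M T) continuousOn_basicSolution polytope_eq_convexHull

end Polytope

/-! ### Choosing one of finitely many closed sets -/

section Selection

open Set

/-- For finitely many closed sets that cover the space, parallel divisions yield numbers from which an
index `i` with `x ∈ C i` can be read off: the numbers always belong to some `O i`, and only to such
`O i` for which `x ∈ C i`.

With functions `d j` and `a j` that vanish exactly on `C 0 ∪ ⋯ ∪ C j` and on `C j`, the numbers are
the quotients of `d j` by `d j + a (j + 1)`. For `x` in `C 0 ∪ ⋯ ∪ C (j + 1)`, a quotient that is not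
`1` shows that already `x ∈ C 0 ∪ ⋯ ∪ C j`, and one that is not `0` shows that `x ∈ C (j + 1)`. -/
theorem exists_parDiv_selection {X : Type} [PseudoMetricSpace X] {C : ℕ → Set X}
    (hC : ∀ i, IsClosed (C i)) (k : ℕ) (hcover : ∀ x, ∃ i ≤ k, x ∈ C i) :
    ∃ O : ℕ → Set (ℕ → ℝ), (∀ i, IsOpen (O i)) ∧
      ParDiv fun x => {q : ℕ → ℝ | (∃ i ≤ k, q ∈ O i) ∧ ∀ i ≤ k, q ∈ O i → x ∈ C i} := by
  classical
  have hE : ∀ i, IsClosed (⋃ l ∈ Iic i, C l) := fun i =>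
    (finite_Iic i).isClosed_biUnion fun l _ => hC l
  choose a ha ha0 haC using fun i => (hC i).isOpen_compl.exists_continuous_pos_iff
  choose d hd hd0 hdE using fun i => (hE i).isOpen_compl.exists_continuous_pos_iff
  have ha' : ∀ i x, x ∈ C i → a i x = 0 := fun i x hx =>
    le_antisymm (not_lt.1 fun h => (haC i x).1 h hx) (ha0 i x)
  have hd' : ∀ i l x, l ≤ i → x ∈ C l → d i x = 0 := fun i l x hl hx =>
    le_antisymm (not_lt.1 fun h => (hdE i x).1 h (mem_biUnion (mem_Iic.2 hl) hx)) (hd0 i x)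
  let O : ℕ → Set (ℕ → ℝ) := fun i =>
    {q | i = 0 ∨ 1 / 3 < q (i - 1)} ∩ ⋂ j ∈ Ico i k, {q | q j < 2 / 3}
  refine ⟨O, fun i => IsOpen.inter ?_ ((finite_Ico i k).isOpen_biInter fun j _ =>
    isOpen_lt (continuous_apply j) continuous_const), ?_⟩
  · rcases eq_or_ne i 0 with h | h
    · simp [h]
    · simpa [h] using isOpen_lt (continuous_const (y := (1 / 3 : ℝ))) (continuous_apply (i - 1))
  have hdiv : ∀ j, ParDiv fun x =>
      {q : ℝ | q ∈ Icc (0 : ℝ) 1 ∧ q * (d j x + a (j + 1) x) = d j x} := fun j =>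
    ParDiv.of_div (hd j) ((hd j).add (ha (j + 1)))
      fun x => ⟨hd0 j x, le_add_of_nonneg_right (ha0 (j + 1) x)⟩
  have hext : Continuous fun (q : Fin k → ℝ) (j : ℕ) => if h : j < k then q ⟨j, h⟩ else 0 := by
    refine continuous_pi fun j => ?_
    by_cases h : j < k
    · simpa only [h, dite_true] using continuous_apply _
    · simpa only [h, dite_false] using continuous_const
  refine ((ParDiv.pi fun j : Fin k => hdiv j).map hext).mono ?_
  rintro x _ ⟨q', hq', rfl⟩
  set q : ℕ → ℝ := fun j => if h : j < k then q' ⟨j, h⟩ else 0 with hq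
  have hqdiv : ∀ j < k, q j * (d j x + a (j + 1) x) = d j x := fun j hj => by
    simpa [hq, hj] using (hq' ⟨j, hj⟩).2
  refine ⟨?_, fun i hi hqi => ?_⟩
  · let p : ℕ → Prop := fun i => i = 0 ∨ 1 / 3 < q (i - 1)
    refine ⟨Nat.findGreatest p k, Nat.findGreatest_le k,
      Nat.findGreatest_spec (P := p) (Nat.zero_le k) (Or.inl rfl), ?_⟩
    simp only [mem_iInter, mem_Ico, mem_ofPred_eq]
    rintro j ⟨hj1, hj2⟩
    have h : ¬p (j + 1) := Nat.findGreatest_is_greatest (Nat.lt_succ_of_le hj1) hj2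
    simp only [p, Nat.add_sub_cancel, not_or, not_lt] at h
    linarith [h.2]
  · obtain ⟨hi1, hi2⟩ := hqi
    simp only [mem_iInter, mem_Ico, mem_ofPred_eq] at hi1 hi2
    have hdesc : ∀ j, i ≤ j → j ≤ k → ∃ l ≤ j, x ∈ C l := by
      intro j hij hjk
      induction hjk using Nat.decreasingInduction with
      | self => exact hcover x
      | of_succ j hj ih =>
        obtain ⟨l, hl, hx⟩ := ih (hij.trans (Nat.le_succ j))
        rcases Nat.lt_or_eq_of_le hl with h | h
        · exact ⟨l, Nat.le_of_lt_succ h, hx⟩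
        · subst h
          by_contra hno
          have hpos : 0 < d j x := (hdE j x).2 (by simpa using hno)
          have h1 := hqdiv j hj
          rw [ha' _ _ hx, add_zero] at h1
          have h2 := hi2 j ⟨hij, hj⟩
          nlinarith
    obtain ⟨l, hl, hx⟩ := hdesc i le_rfl hi
    rcases Nat.lt_or_eq_of_le hl with h | h
    · have hi0 : i ≠ 0 := Nat.ne_of_gt (Nat.zero_lt_of_lt h)
      obtain ⟨j, rfl⟩ := Nat.exists_eq_succ_of_ne_zero hi0
      by_contra hno
      have hpos : 0 < a (j + 1) x := (haC (j + 1) x).2 hno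
      have h1 := hqdiv j hi
      rw [hd' j l x (Nat.le_of_lt_succ h) hx, zero_add] at h1
      have h2 := hi1.resolve_left hi0
      rw [Nat.succ_eq_add_one, Nat.add_sub_cancel] at h2
      nlinarith
    · exact h ▸ hx

end Selection

/-! ### Nash equilibria with given supports -/

section Supports

open Set
open scoped Matrix

/-- A mixed strategy is a best response to the payoffs `a` iff it only uses best pure strategies. -/
theorem forall_dotProduct_le_iff {ι : Type} [Fintype ι] [DecidableEq ι] {x a : ι → ℝ}
    (hx : x ∈ stdSimplex ℝ ι) :
    (∀ x' ∈ stdSimplex ℝ ι, x' ⬝ᵥ a ≤ x ⬝ᵥ a) ↔ ∀ i, x i ≠ 0 → ∀ k, a k ≤ a i := by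
  constructor
  · intro h i hi k
    have hle : ∀ l, a l ≤ x ⬝ᵥ a := fun l => by
      simpa using h (Pi.single l 1) (single_mem_stdSimplex ℝ l)
    have hsum : ∑ l, x l * (x ⬝ᵥ a - a l) = 0 := by
      simp only [mul_sub, Finset.sum_sub_distrib, ← Finset.sum_mul, hx.2, one_mul]
      exact sub_self _
    have h0 := (Finset.sum_eq_zero_iff_of_nonneg fun l _ =>
      mul_nonneg (hx.1 l) (sub_nonneg.2 (hle l))).1 hsum i (Finset.mem_univ i)
    have h1 := (mul_eq_zero.1 h0).resolve_left hi
    linarith [hle k]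
  · intro h x' hx'
    refine dotProduct_le_of_mem_stdSimplex hx' fun k => ?_
    calc a k = ∑ i, x i * a k := by rw [← Finset.sum_mul, hx.2, one_mul]
      _ ≤ x ⬝ᵥ a := Finset.sum_le_sum fun i _ => by
        by_cases hi : x i = 0
        · simp [hi]
        · exact mul_le_mul_of_nonneg_left (h i hi k) (hx.1 i)

variable {I J : Type} [DecidableEq I] [DecidableEq J]

/-- The inequalities which say that for a mixed strategy `y`, all members of `S` are best responses
with respect to the payoff matrix `A`, and that the support of `y` is contained in `T`. -/
def supportSystem (S : Finset I) (T : Finset J) (A : I → J → ℝ) : (I × I) ⊕ J → J → ℝ :=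
  Sum.elim (fun p => if p.1 ∈ S then A p.1 - A p.2 else 0)
    (fun j => if j ∈ T then 0 else -Pi.single j 1)

theorem continuous_supportSystem (S : Finset I) (T : Finset J) :
    Continuous (supportSystem S T) := by
  refine continuous_pi fun c => ?_
  rcases c with p | j
  · by_cases h : p.1 ∈ S
    · simp only [supportSystem, Sum.elim_inl, h, if_true]
      fun_prop
    · simpa only [supportSystem, Sum.elim_inl, h, if_false] using continuous_const
  · exact continuous_const

theorem mem_polytope_supportSystem [Fintype J] {S : Finset I} {T : Finset J} {A : I → J → ℝ}
    {y : J → ℝ} :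
    y ∈ polytope (supportSystem S T A) ↔ y ∈ stdSimplex ℝ J ∧
      (∀ i ∈ S, ∀ k, A k ⬝ᵥ y ≤ A i ⬝ᵥ y) ∧ ∀ j, y j ≠ 0 → j ∈ T := by
  rw [mem_polytope]
  refine and_congr_right fun hy => ?_
  rw [Sum.forall]
  refine and_congr ⟨fun h i hi k => ?_, fun h p => ?_⟩ ⟨fun h j hj => ?_, fun h j => ?_⟩
  · have := h (i, k)
    simp only [supportSystem, Sum.elim_inl, hi, if_true, sub_dotProduct] at this
    linarith
  · by_cases hp : p.1 ∈ S
    · simp only [supportSystem, Sum.elim_inl, hp, if_true, sub_dotProduct]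
      linarith [h p.1 hp p.2]
    · simp [supportSystem, hp]
  · by_contra hjT
    have := h j
    simp only [supportSystem, Sum.elim_inr, hjT, if_false, neg_dotProduct,
      single_one_dotProduct] at this
    exact hj (le_antisymm (by linarith) (hy.1 j))
  · by_cases hjT : j ∈ T
    · simp [supportSystem, hjT]
    · have : y j = 0 := by_contra fun hj => hjT (h j hj)
      simp [supportSystem, hjT, this]

theorem isNashEquilibrium_of_mem_polytope {n m : ℕ} {A B : Fin n → Fin m → ℝ} {x : Fin n → ℝ}
    {y : Fin m → ℝ} {S : Finset (Fin n)} {T : Finset (Fin m)}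
    (hx : x ∈ polytope (supportSystem T S fun j i => B i j))
    (hy : y ∈ polytope (supportSystem S T A)) :
    IsNashEquilibrium (Matrix.of A) (Matrix.of B) x y := by
  rw [mem_polytope_supportSystem] at hx hy
  refine ⟨hx.1, hy.1, (forall_dotProduct_le_iff hx.1).2 fun i hi => hy.2.1 i (hx.2.2 i hi), ?_⟩
  have h := (forall_dotProduct_le_iff (a := x ᵥ* Matrix.of B) hy.1).2 fun j hj k => by
    have := hx.2.1 j (hy.2.2 j hj) k
    rwa [dotProduct_comm, dotProduct_comm _ x] at this
  intro y' hy'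
  rw [Matrix.dotProduct_mulVec, Matrix.dotProduct_mulVec, dotProduct_comm, dotProduct_comm _ y]
  exact h y' hy'

theorem exists_mem_polytope_of_isNashEquilibrium {n m : ℕ} {A B : Fin n → Fin m → ℝ}
    {x : Fin n → ℝ} {y : Fin m → ℝ} (h : IsNashEquilibrium (Matrix.of A) (Matrix.of B) x y) :
    ∃ (S : Finset (Fin n)) (T : Finset (Fin m)),
      x ∈ polytope (supportSystem T S fun j i => B i j) ∧ y ∈ polytope (supportSystem S T A) := by
  classical
  obtain ⟨hx, hy, hA, hB⟩ := h
  refine ⟨Finset.univ.filter fun i => x i ≠ 0, Finset.univ.filter fun j => y j ≠ 0,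
    mem_polytope_supportSystem.2 ⟨hx, fun j hj k => ?_, by simp⟩,
    mem_polytope_supportSystem.2 ⟨hy, fun i hi =>
      (forall_dotProduct_le_iff hx).1 hA i (Finset.mem_filter.1 hi).2, by simp⟩⟩
  have h := (forall_dotProduct_le_iff (a := x ᵥ* Matrix.of B) hy).1 (fun y' hy' => by
    have := hB y' hy'
    rwa [Matrix.dotProduct_mulVec, Matrix.dotProduct_mulVec, dotProduct_comm,
      dotProduct_comm _ y] at this) j (Finset.mem_filter.1 hj).2 k
  rwa [dotProduct_comm, dotProduct_comm _ x]

theorem isClosed_polytope_nonempty {K : Type} [Fintype J] :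
    IsClosed {M : K → J → ℝ | (polytope M).Nonempty} := by
  have h : {M : K → J → ℝ | (polytope M).Nonempty} = Prod.fst ''
      {z : (K → J → ℝ) × Icc (0 : J → ℝ) 1 | (z.2 : J → ℝ) ∈ polytope z.1} := by
    ext M
    constructor
    · rintro ⟨y, hy⟩
      exact ⟨(M, ⟨y, polytope_subset_Icc M hy⟩), hy, rfl⟩
    · rintro ⟨z, hz, rfl⟩
      exact ⟨_, hz⟩
  rw [h]
  exact isClosedMap_fst_of_compactSpace _ (isClosed_polytope_graph.preimage
    (f := fun z : (K → J → ℝ) × Icc (0 : J → ℝ) 1 => (z.1, (z.2 : J → ℝ))) (by fun_prop))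

/-- Parallel divisions yield, for a bimatrix game, candidates for a Nash equilibrium, one for each
pair of supports, and numbers from which one can read off which of the candidates may be used. -/
theorem exists_parDiv_isNashEquilibrium {n m : ℕ} (hn : 0 < n) (hm : 0 < m) :
    ∃ O : ℕ → Set (ℕ → ℝ), (∀ i, IsOpen (O i)) ∧ ∃ k : ℕ,
      ParDiv fun g : (Fin n → Fin m → ℝ) × (Fin n → Fin m → ℝ) =>
        {r : (ℕ → ℝ) × (Fin (k + 1) → (Fin n → ℝ) × (Fin m → ℝ)) | (∃ i ≤ k, r.1 ∈ O i) ∧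
          ∀ i : Fin (k + 1), r.1 ∈ O i →
            IsNashEquilibrium (Matrix.of g.1) (Matrix.of g.2) (r.2 i).1 (r.2 i).2} := by
  classical
  obtain ⟨k, e, he⟩ : ∃ (k : ℕ) (e : Fin (k + 1) → Finset (Fin n) × Finset (Fin m)),
      Function.Surjective e := by
    let N := Fintype.card (Finset (Fin n) × Finset (Fin m))
    obtain ⟨k, hk⟩ := Nat.exists_eq_succ_of_ne_zero
      (Fintype.card_ne_zero (α := Finset (Fin n) × Finset (Fin m)))
    exact ⟨k, (Fintype.equivFinOfCardEq hk).symm, Equiv.surjective _⟩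
  let sysX : Fin (k + 1) → (Fin n → Fin m → ℝ) × (Fin n → Fin m → ℝ) →
      (Fin m × Fin m) ⊕ Fin n → Fin n → ℝ := fun i g =>
    supportSystem (e i).2 (e i).1 fun j l => g.2 l j
  let sysY : Fin (k + 1) → (Fin n → Fin m → ℝ) × (Fin n → Fin m → ℝ) →
      (Fin n × Fin n) ⊕ Fin m → Fin m → ℝ := fun i g =>
    supportSystem (e i).1 (e i).2 g.1
  have hX : ∀ i, Continuous (sysX i) := fun i =>
    (continuous_supportSystem _ _).comp (by fun_prop)
  have hY : ∀ i, Continuous (sysY i) := fun i => (continuous_supportSystem _ _).comp (by fun_prop)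
  let C : ℕ → Set ((Fin n → Fin m → ℝ) × (Fin n → Fin m → ℝ)) := fun i => {g | ∃ h : i < k + 1,
    (polytope (sysX ⟨i, h⟩ g)).Nonempty ∧ (polytope (sysY ⟨i, h⟩ g)).Nonempty}
  have hC : ∀ i, IsClosed (C i) := by
    intro i
    by_cases h : i < k + 1
    · simp only [C, h, exists_true_left]
      exact (isClosed_polytope_nonempty.preimage (hX ⟨i, h⟩)).inter
        (isClosed_polytope_nonempty.preimage (hY ⟨i, h⟩))
    · simp only [C, h, IsEmpty.exists_iff]
      exact isClosed_empty
  obtain ⟨O, hO, hsel⟩ := exists_parDiv_selection hC k (by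
    intro g
    obtain ⟨x, y, hxy⟩ := exists_isNashEquilibrium hn hm (Matrix.of g.1) (Matrix.of g.2)
    obtain ⟨S, T, hx, hy⟩ := exists_mem_polytope_of_isNashEquilibrium hxy
    obtain ⟨i, hi⟩ := he (S, T)
    refine ⟨i, Nat.le_of_lt_succ i.2, i.2, ⟨x, ?_⟩, ⟨y, ?_⟩⟩
    · simpa only [sysX, hi] using hx
    · simpa only [sysY, hi] using hy)
  refine ⟨O, hO, k, (hsel.prod (ParDiv.pi fun i : Fin (k + 1) =>
    (parDiv_polytope.comp (hX i)).prod (parDiv_polytope.comp (hY i)))).mono ?_⟩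
  rintro g ⟨q, xy⟩ ⟨hq, hxy⟩
  refine ⟨hq.1, fun i hi => ?_⟩
  obtain ⟨_, hne⟩ := hq.2 i (Nat.le_of_lt_succ i.2) hi
  exact isNashEquilibrium_of_mem_polytope ((hxy i).1 hne.1) ((hxy i).2 hne.2)

end Supports

/-! ### Names of real numbers -/

section Names

open Set Topology

theorem continuous_ratCast_apply (ν : ℕ ≃ ℚ) (i : ℕ) :
    Continuous fun u : Baire => ((ν (u i) : ℚ) : ℝ) :=
  (continuous_of_discreteTopology (f := fun k : ℕ => ((ν k : ℚ) : ℝ))).comp (continuous_apply i)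

/-- A continuous function on all sequences that maps a name to the real number that it denotes. The
increments are truncated, which has no effect on names and makes the series converge. -/
noncomputable def realValue (ν : ℕ ≃ ℚ) (u : Baire) : ℝ :=
  (ν (u 0) : ℚ) + ∑' i : ℕ, max (-(2 * (1 / 2 : ℝ) ^ i)) (min (2 * (1 / 2 : ℝ) ^ i)
    (((ν (u (i + 1)) : ℚ) : ℝ) - (ν (u i) : ℚ)))

theorem norm_truncate_le {c : ℝ} (hc : 0 ≤ c) (a : ℝ) : ‖max (-c) (min c a)‖ ≤ c := by
  rw [Real.norm_eq_abs, abs_le]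
  exact ⟨le_max_left _ _, max_le (by linarith) (min_le_left _ _)⟩

theorem continuous_realValue (ν : ℕ ≃ ℚ) : Continuous (realValue ν) := by
  have hc := continuous_ratCast_apply ν
  refine (hc 0).add (continuous_tsum (fun i => ?_) (summable_geometric_two.mul_left 2)
    fun i u => norm_truncate_le (by positivity) _)
  exact continuous_const.max (continuous_const.min ((hc (i + 1)).sub (hc i)))

theorem IsRealName.realValue_eq {ν : ℕ ≃ ℚ} {u : Baire} {x : ℝ} (h : IsRealName ν u x) :
    realValue ν u = x := by
  have hterm : ∀ i : ℕ, max (-(2 * (1 / 2 : ℝ) ^ i)) (min (2 * (1 / 2 : ℝ) ^ i)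
      (((ν (u (i + 1)) : ℚ) : ℝ) - (ν (u i) : ℚ))) = ((ν (u (i + 1)) : ℚ) : ℝ) - (ν (u i) : ℚ) := by
    intro i
    have h1 := abs_le.1 (h i)
    have h2 := abs_le.1 (h (i + 1))
    have h3 : (1 / 2 : ℝ) ^ (i + 1) ≤ (1 / 2) ^ i :=
      pow_le_pow_of_le_one (by norm_num) (by norm_num) (Nat.le_succ i)
    rw [min_eq_right (by linarith), max_eq_right (by linarith)]
  have hsum : Summable fun i : ℕ => ((ν (u (i + 1)) : ℚ) : ℝ) - (ν (u i) : ℚ) :=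
    Summable.of_norm_bounded (summable_geometric_two.mul_left 2) fun i => by
      rw [← hterm i]
      exact norm_truncate_le (by positivity) _
  have hlim : Filter.Tendsto (fun i => ((ν (u i) : ℚ) : ℝ)) Filter.atTop (𝓝 x) :=
    tendsto_iff_norm_sub_tendsto_zero.2 (squeeze_zero (fun _ => norm_nonneg _) h
      (tendsto_pow_atTop_nhds_zero_of_lt_one (by norm_num) (by norm_num)))
  have htsum := tendsto_nhds_unique hsum.hasSum.tendsto_sum_nat (by
    simp only [Finset.sum_range_sub fun i => ((ν (u i) : ℚ) : ℝ)]
    exact hlim.sub_const _)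
  simp only [realValue, hterm, htsum, add_sub_cancel]

/-- Every point has a neighbourhood basis of clopen sets. -/
def HasClopenNhds (X : Type) [TopologicalSpace X] : Prop :=
  ∀ x : X, ∀ U ∈ 𝓝 x, ∃ V, IsClopen V ∧ x ∈ V ∧ V ⊆ U

namespace HasClopenNhds

variable {X Y : Type} [TopologicalSpace X] [TopologicalSpace Y]

theorem of_discrete [DiscreteTopology X] : HasClopenNhds X := fun x _ hU =>
  ⟨{x}, isClopen_discrete _, mem_singleton x, singleton_subset_iff.2 (mem_of_mem_nhds hU)⟩

theorem of_isInducing (hY : HasClopenNhds Y) {f : X → Y} (hf : IsInducing f) :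
    HasClopenNhds X := by
  intro x U hU
  rw [hf.nhds_eq_comap, Filter.mem_comap] at hU
  obtain ⟨U', hU', hsub⟩ := hU
  obtain ⟨V, hV, hx, hVU⟩ := hY (f x) U' hU'
  exact ⟨f ⁻¹' V, hV.preimage hf.continuous, hx, (preimage_mono hVU).trans hsub⟩

theorem prod (hX : HasClopenNhds X) (hY : HasClopenNhds Y) : HasClopenNhds (X × Y) := by
  rintro ⟨x, y⟩ U hU
  rw [nhds_prod_eq, Filter.mem_prod_iff] at hU
  obtain ⟨U₁, hU₁, U₂, hU₂, hsub⟩ := hU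
  obtain ⟨V₁, hV₁, hx, hVU₁⟩ := hX x U₁ hU₁
  obtain ⟨V₂, hV₂, hy, hVU₂⟩ := hY y U₂ hU₂
  exact ⟨V₁ ×ˢ V₂, hV₁.prod hV₂, ⟨hx, hy⟩, (prod_mono hVU₁ hVU₂).trans hsub⟩

theorem pi {ι : Type} {Z : ι → Type} [∀ i, TopologicalSpace (Z i)] (h : ∀ i, HasClopenNhds (Z i)) :
    HasClopenNhds (∀ i, Z i) := by
  classical
  intro x U hU
  rw [nhds_pi, Filter.mem_pi] at hU
  obtain ⟨s, hs, t, ht, hsub⟩ := hU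
  choose V hV hx hVt using fun i => h i (x i) (t i) (ht i)
  refine ⟨s.pi V, ?_, fun i _ => hx i, (pi_mono fun i _ => hVt i).trans hsub⟩
  rw [pi_def]
  exact hs.isClopen_biInter fun i _ => (hV i).preimage (continuous_apply i)

theorem sigma {ι : Type} {Z : ι → Type} [∀ i, TopologicalSpace (Z i)]
    (h : ∀ i, HasClopenNhds (Z i)) : HasClopenNhds (Σ i, Z i) := by
  rintro ⟨i, x⟩ U hU
  obtain ⟨V, hV, hx, hVU⟩ := h i x (Sigma.mk i ⁻¹' U)
    (continuous_sigmaMk.continuousAt.preimage_mem_nhds hU)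
  exact ⟨Sigma.mk i '' V, ⟨isClosedMap_sigmaMk _ hV.1, isOpenMap_sigmaMk _ hV.2⟩,
    mem_image_of_mem _ hx, image_subset_iff.2 hVU⟩

/-- A countable open cover of a zero-dimensional second countable space has a continuous choice
function: refine it to a sequence of clopen sets, and take the first one that contains the point. -/
theorem exists_continuous_choice [SecondCountableTopology X] (hX : HasClopenNhds X) {ι : Type}
    [TopologicalSpace ι] {O : ι → Set X} (hO : ∀ i, IsOpen (O i)) (hcover : ∀ x, ∃ i, x ∈ O i) :
    ∃ σ : X → ι, Continuous σ ∧ ∀ x, x ∈ O (σ x) := by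
  classical
  rcases isEmpty_or_nonempty X with hemp | hne
  · exact ⟨fun x => (hemp.false x).elim, continuous_of_const fun x => (hemp.false x).elim,
      fun x => (hemp.false x).elim⟩
  choose i hi using hcover
  choose V hV hx hVO using fun x => hX x (O (i x)) ((hO (i x)).mem_nhds (hi x))
  obtain ⟨s, hs, hsV⟩ := TopologicalSpace.countable_cover_nhds
    fun x => (hV x).isOpen.mem_nhds (hx x)
  have hs0 : s.Nonempty := by
    by_contra h
    rw [not_nonempty_iff_eq_empty.1 h] at hsV
    simp only [mem_empty_iff_false, iUnion_of_empty, iUnion_empty] at hsV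
    exact (hsV.symm ▸ mem_univ (Classical.arbitrary X) :
      Classical.arbitrary X ∈ (∅ : Set X))
  obtain ⟨f, rfl⟩ := hs.exists_eq_range hs0
  have hN : ∀ x, ∃ n, x ∈ V (f n) := fun x => by
    have : x ∈ ⋃ y ∈ range f, V y := hsV ▸ mem_univ x
    simpa using this
  refine ⟨fun x => i (f (Nat.find (hN x))), ?_, fun x => hVO _ (Nat.find_spec (hN x))⟩
  refine IsLocallyConstant.continuous (IsLocallyConstant.iff_eventually_eq _ |>.2 fun x => ?_)
  have h1 : ∀ᶠ y in 𝓝 x, y ∈ V (f (Nat.find (hN x))) :=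
    (hV _).isOpen.mem_nhds (Nat.find_spec (hN x))
  have h2 : ∀ᶠ y in 𝓝 x, ∀ k ∈ Iio (Nat.find (hN x)), y ∉ V (f k) :=
    (finite_Iio _).eventually_all.2 fun k hk =>
      (hV _).isClosed.isOpen_compl.mem_nhds (Nat.find_min (hN x) hk)
  filter_upwards [h1, h2] with y hy1 hy2
  have : Nat.find (hN y) = Nat.find (hN x) := (Nat.find_eq_iff _).2 ⟨hy1, fun k hk => hy2 k hk⟩
  rw [this]

/-- On a zero-dimensional second countable space, a continuous real function has a continuous lift to
names. -/
theorem exists_continuous_isRealName [SecondCountableTopology X] (hX : HasClopenNhds X) (ν : ℕ ≃ ℚ)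
    {f : X → ℝ} (hf : Continuous f) :
    ∃ u : X → Baire, Continuous u ∧ ∀ x, IsRealName ν (u x) (f x) := by
  have h : ∀ i : ℕ, ∃ σ : X → ℕ, Continuous σ ∧
      ∀ x, x ∈ {x | |((ν (σ x) : ℚ) : ℝ) - f x| < (1 / 2 : ℝ) ^ i} := fun i =>
    exists_continuous_choice hX (O := fun k => {x | |((ν k : ℚ) : ℝ) - f x| < (1 / 2 : ℝ) ^ i})
      (fun k => isOpen_lt (by fun_prop) continuous_const) fun x => by
        obtain ⟨r, hr⟩ := Rat.denseRange_cast.exists_dist_lt (f x)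
          (show (0 : ℝ) < (1 / 2) ^ i by positivity)
        refine ⟨ν.symm r, ?_⟩
        rw [mem_ofPred_eq, ν.apply_symm_apply, ← Real.dist_eq, dist_comm]
        exact hr
  choose σ hσ hσf using h
  exact ⟨fun x i => σ i x, continuous_pi hσ, fun x i => (hσf i x).le⟩

end HasClopenNhds

theorem hasClopenNhds_baire : HasClopenNhds Baire := HasClopenNhds.pi fun _ => .of_discrete

theorem continuous_apply_of_discrete {X Y ι : Type} [TopologicalSpace X] [TopologicalSpace Y]
    [TopologicalSpace ι] [DiscreteTopology ι] {s : X → ι} (hs : Continuous s) {f : ι → X → Y}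
    (hf : ∀ i, Continuous (f i)) : Continuous fun x => f (s x) x := by
  rw [continuous_iff_continuousAt]
  intro x
  refine (hf (s x)).continuousAt.congr ?_
  filter_upwards [hs.continuousAt.preimage_mem_nhds ((isOpen_discrete {s x}).mem_nhds rfl)] with y hy
  rw [show s y = s x from hy]

end Names

/-! ### Names of games and of pairs of strategies -/

section GameNames

open Set Topology

theorem HasSizePrefix.unique {w : Baire} {n m n' m' : ℕ} (hm : 0 < m) (hm' : 0 < m')
    (h : HasSizePrefix w n m) (h' : HasSizePrefix w n' m') : n = n' ∧ m = m' := by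
  have key : ∀ {n m n' m' : ℕ}, 0 < m → HasSizePrefix w n m → HasSizePrefix w n' m' → ¬n < n' := by
    intro n m n' m' hm h h' hlt
    have h1 := h.2.1 0 hm
    have h2 := h'.1 n hlt
    rw [add_zero] at h1
    omega
  have key' : ∀ {n m m' : ℕ}, HasSizePrefix w n m → HasSizePrefix w n m' → ¬m < m' := by
    intro n m m' h h' hlt
    have h1 := h.2.2
    have h2 := h'.2.1 m hlt
    omega
  have hn : n = n' := le_antisymm (not_lt.1 (key hm' h' h)) (not_lt.1 (key hm h h'))
  subst hn
  exact ⟨rfl, le_antisymm (not_lt.1 (key' h' h)) (not_lt.1 (key' h h'))⟩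

theorem isOpen_hasSizePrefix (n m : ℕ) : IsOpen {w : Baire | HasSizePrefix w n m} := by
  have h : ∀ i c : ℕ, IsOpen {w : Baire | w i = c} := fun i c =>
    (isOpen_discrete ({c} : Set ℕ)).preimage (continuous_apply (A := fun _ : ℕ => ℕ) i)
  have heq : {w : Baire | HasSizePrefix w n m} = (⋂ i ∈ Iio n, {w : Baire | w i = 0}) ∩
      ((⋂ i ∈ Iio m, {w : Baire | w (n + i) = 1}) ∩ {w : Baire | w (n + m) = 0}) := by
    ext w
    simp [HasSizePrefix]
  rw [heq]
  exact ((finite_Iio n).isOpen_biInter fun i _ => h i 0).inter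
    (((finite_Iio m).isOpen_biInter fun i _ => h _ 1).inter (h _ 0))

/-- On the names of bimatrix games, the size is a continuous function. -/
theorem exists_continuous_size (ν : ℕ ≃ ℚ) :
    ∃ s : (Nash ν).dom → ℕ × ℕ, Continuous s ∧
      ∀ (w : (Nash ν).dom) (n m : ℕ) (A B : Matrix (Fin n) (Fin m) ℝ), IsGameName ν w A B →
        s w = (n, m) := by
  have hex : ∀ w : (Nash ν).dom, ∃ p : ℕ × ℕ, 0 < p.2 ∧ HasSizePrefix w p.1 p.2 := by
    rintro ⟨w, n, m, A, B, h⟩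
    exact ⟨(n, m), h.2.1, h.2.2.1⟩
  choose s hs0 hs using hex
  have huniq : ∀ (w : (Nash ν).dom) (p : ℕ × ℕ), 0 < p.2 → HasSizePrefix w p.1 p.2 → s w = p := by
    intro w p hp h
    obtain ⟨h1, h2⟩ := (hs w).unique (hs0 w) hp h
    exact Prod.ext h1 h2
  refine ⟨s, ?_, fun w n m A B h => huniq w (n, m) h.2.1 h.2.2.1⟩
  refine IsLocallyConstant.continuous (IsLocallyConstant.iff_eventually_eq _ |>.2 fun w => ?_)
  filter_upwards [((isOpen_hasSizePrefix (s w).1 (s w).2).preimage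
    continuous_subtype_val).mem_nhds (hs w)] with w' hw'
  exact huniq w' (s w) (hs0 w) hw'

/-- The payoff matrices that are denoted by a sequence, read as the name of an `n × m` game. -/
noncomputable def gameValue (ν : ℕ ≃ ℚ) (n m : ℕ) (w : Baire) :
    (Fin n → Fin m → ℝ) × (Fin n → Fin m → ℝ) :=
  (fun i j => realValue ν
      (component (n * m) (n * (j : ℕ) + i) (component 2 0 (dropPrefix n m w))),
    fun i j => realValue ν
      (component (n * m) (n * (j : ℕ) + i) (component 2 1 (dropPrefix n m w))))

theorem continuous_gameValue (ν : ℕ ≃ ℚ) (n m : ℕ) : Continuous (gameValue ν n m) := by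
  have h : ∀ c k i : ℕ, Continuous fun w : Baire =>
      realValue ν (component k i (component 2 c (dropPrefix n m w))) := fun c k i =>
    (continuous_realValue ν).comp (continuous_pi fun t => continuous_apply _)
  exact (continuous_pi fun i => continuous_pi fun j => h _ _ _).prodMk
    (continuous_pi fun i => continuous_pi fun j => h _ _ _)

theorem IsGameName.gameValue_eq {ν : ℕ ≃ ℚ} {w : Baire} {n m : ℕ}
    {A B : Matrix (Fin n) (Fin m) ℝ} (h : IsGameName ν w A B) : gameValue ν n m w = (A, B) :=
  Prod.ext (funext fun i => funext fun j => (h.2.2.2.1 i j).realValue_eq)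
    (funext fun i => funext fun j => (h.2.2.2.2 i j).realValue_eq)

/-- The sequence `0ⁿ 1ᵐ 0 ⟨⟨u 0, …, u (n - 1)⟩, ⟨v 0, …, v (m - 1)⟩⟩`. -/
def strategyPairName (n m : ℕ) (u v : ℕ → Baire) : Baire := fun t =>
  if t < n then 0 else if t < n + m then 1 else if t = n + m then 0 else
    if (t - (n + m + 1)) % 2 = 0 then u ((t - (n + m + 1)) / 2 % n) ((t - (n + m + 1)) / 2 / n)
    else v ((t - (n + m + 1)) / 2 % m) ((t - (n + m + 1)) / 2 / m)

theorem isStrategyPairName_strategyPairName {ν : ℕ ≃ ℚ} {n m : ℕ} {u v : ℕ → Baire}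
    {x : Fin n → ℝ} {y : Fin m → ℝ} (hx : ∀ i : Fin n, IsRealName ν (u i) (x i))
    (hy : ∀ j : Fin m, IsRealName ν (v j) (y j)) :
    IsStrategyPairName ν (strategyPairName n m u v) x y := by
  refine ⟨⟨fun i hi => ?_, fun i hi => ?_, ?_⟩, fun i => ?_, fun j => ?_⟩
  · simp [strategyPairName, hi]
  · simp [strategyPairName, hi]
  · simp [strategyPairName]
  · have h : component n i (component 2 0 (dropPrefix n m (strategyPairName n m u v))) = u i := by
      funext t
      have h1 : ¬n + m + 1 + (2 * (n * t + i) + 0) < n := by omega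
      have h2 : ¬n + m + 1 + (2 * (n * t + i) + 0) < n + m := by omega
      have h3 : ¬n + m + 1 + (2 * (n * t + i) + 0) = n + m := by omega
      have h4 : (2 * (n * t + i) + 0) % 2 = 0 := by omega
      have h5 : (2 * (n * t + i) + 0) / 2 = n * t + i := by omega
      simp only [component, dropPrefix, strategyPairName, h1, h2, h3, if_false, Nat.add_sub_cancel_left,
        h4, if_true, h5]
      rw [Nat.mul_add_mod, Nat.mod_eq_of_lt i.2, Nat.mul_add_div i.pos, Nat.div_eq_of_lt i.2, add_zero]
    rw [h]
    exact hx i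
  · have h : component m j (component 2 1 (dropPrefix n m (strategyPairName n m u v))) = v j := by
      funext t
      have h1 : ¬n + m + 1 + (2 * (m * t + j) + 1) < n := by omega
      have h2 : ¬n + m + 1 + (2 * (m * t + j) + 1) < n + m := by omega
      have h3 : ¬n + m + 1 + (2 * (m * t + j) + 1) = n + m := by omega
      have h4 : ¬(2 * (m * t + j) + 1) % 2 = 0 := by omega
      have h5 : (2 * (m * t + j) + 1) / 2 = m * t + j := by omega
      simp only [component, dropPrefix, strategyPairName, h1, h2, h3, if_false, Nat.add_sub_cancel_left,
        h4, h5]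
      rw [Nat.mul_add_mod, Nat.mod_eq_of_lt j.2, Nat.mul_add_div j.pos, Nat.div_eq_of_lt j.2, add_zero]
    rw [h]
    exact hy j

theorem continuous_strategyPairName {X : Type} [TopologicalSpace X] (n m : ℕ)
    {u v : ℕ → X → Baire} (hu : ∀ i, Continuous (u i)) (hv : ∀ j, Continuous (v j)) :
    Continuous fun x => strategyPairName n m (fun i => u i x) fun j => v j x := by
  refine continuous_pi fun t => ?_
  simp only [strategyPairName]
  split_ifs
  · exact continuous_const
  · exact continuous_const
  · exact continuous_const
  · exact (continuous_apply _).comp (hu _)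
  · exact (continuous_apply _).comp (hv _)

end GameNames

/-! ### The reduction -/

section Reduction

open Set Topology

/-- For games of a fixed size: dividends and divisors, as functions of the name of a game, such that
any quotients `q` determine a Nash equilibrium. The members of the countable family of candidates
that are one are recognized by the open sets `O k`. -/
theorem exists_division_scheme (ν : ℕ ≃ ℚ) (n m : ℕ) :
    ∃ (z : ℕ+) (num den : Baire → ℕ → ℝ) (O : ℕ → Set (ℕ → ℝ)) (x y : ℕ → (ℕ → ℝ) → ℕ → ℝ),
      (∀ i, Continuous fun w => num w i) ∧ (∀ i, Continuous fun w => den w i) ∧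
      (∀ w i, 0 ≤ num w i ∧ num w i ≤ den w i) ∧ (∀ k, IsOpen (O k)) ∧
      (∀ k i, Continuous fun q => x k q i) ∧ (∀ k i, Continuous fun q => y k q i) ∧
      ∀ (w : Baire) (A B : Matrix (Fin n) (Fin m) ℝ), IsGameName ν w A B → ∀ q : ℕ → ℝ,
        (∀ i < (z : ℕ), q i ∈ Icc (0 : ℝ) 1 ∧ q i * den w i = num w i) →
        (∃ k, q ∈ O k) ∧
          ∀ k, q ∈ O k → IsNashEquilibrium A B (fun i => x k q i) fun j => y k q j := by
  classical
  by_cases hnm : 0 < n ∧ 0 < m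
  · obtain ⟨O, hO, k, ι, hι, num, den, out, hnum, hden, hout, hle, hsol⟩ :=
      exists_parDiv_isNashEquilibrium hnm.1 hnm.2
    let e := Fintype.equivFin ι
    let c := Fintype.card ι
    let out' : (ℕ → ℝ) → (ℕ → ℝ) × (Fin (k + 1) → (Fin n → ℝ) × (Fin m → ℝ)) := fun q =>
      out fun i => q (e i)
    have hout' : Continuous out' := hout.comp (by fun_prop)
    have hg := continuous_gameValue ν n m
    refine ⟨⟨c + 1, Nat.succ_pos c⟩,
      fun w i => if h : i < c then num (gameValue ν n m w) (e.symm ⟨i, h⟩) else 0,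
      fun w i => if h : i < c then den (gameValue ν n m w) (e.symm ⟨i, h⟩) else 0,
      fun l => if l ≤ k then {q | (out' q).1 ∈ O l} else ∅,
      fun l q i => if h : l < k + 1 ∧ i < n then ((out' q).2 ⟨l, h.1⟩).1 ⟨i, h.2⟩ else 0,
      fun l q j => if h : l < k + 1 ∧ j < m then ((out' q).2 ⟨l, h.1⟩).2 ⟨j, h.2⟩ else 0,
      fun i => ?_, fun i => ?_, fun w i => ?_, fun l => ?_, fun l i => ?_, fun l j => ?_, ?_⟩
    · by_cases h : i < c
      · simp only [h, dite_true]
        exact (continuous_apply _).comp (hnum.comp hg)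
      · simpa only [h, dite_false] using continuous_const
    · by_cases h : i < c
      · simp only [h, dite_true]
        exact (continuous_apply _).comp (hden.comp hg)
      · simpa only [h, dite_false] using continuous_const
    · by_cases h : i < c
      · simpa only [h, dite_true] using hle _ _
      · simp [h]
    · by_cases h : l ≤ k
      · simp only [h, if_true]
        exact (hO l).preimage (continuous_fst.comp hout')
      · simp [h]
    · by_cases h : l < k + 1 ∧ i < n
      · simp only [h, and_self, dite_true]
        fun_prop
      · simpa only [h, dite_false] using continuous_const
    · by_cases h : l < k + 1 ∧ j < m
      · simp only [h, and_self, dite_true]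
        fun_prop
      · simpa only [h, dite_false] using continuous_const
    · intro w A B hw q hq
      obtain ⟨⟨l, hl, hlO⟩, hall⟩ := hsol (gameValue ν n m w) (fun i => q (e i)) fun i => by
        have h := hq (e i) (lt_trans (e i).2 (Nat.lt_succ_self c))
        have hi : ((e i : Fin c) : ℕ) < c := (e i).2
        simpa only [hi, dite_true, Fin.eta, Equiv.symm_apply_apply] using h
      rw [hw.gameValue_eq] at hall
      refine ⟨⟨l, by simp only [hl, if_true]; exact hlO⟩, fun l' hl' => ?_⟩
      by_cases h : l' ≤ k
      · simp only [h, if_true] at hl'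
        simp only [Nat.lt_succ_of_le h, Fin.is_lt, and_self, dite_true, Fin.eta]
        exact hall ⟨l', Nat.lt_succ_of_le h⟩ hl'
      · simp [h] at hl'
  · exact ⟨1, 0, 0, fun _ => ∅, 0, 0, fun _ => continuous_const, fun _ => continuous_const,
      fun _ _ => ⟨le_rfl, le_rfl⟩, fun _ => isOpen_empty, fun _ _ => continuous_const,
      fun _ _ => continuous_const, fun w A B hw => absurd ⟨hw.1, hw.2.1⟩ hnm⟩

/-- The numbers in `[0, 1]` that are denoted by the outcomes of divisions. Outcomes of divisions by `0`
need not be names, but are given some value too. -/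
noncomputable def quotients (ν : ℕ ≃ ℚ) (v : Σ z : ℕ+, Fin (z : ℕ) → Baire) (i : ℕ) : ℝ :=
  if h : i < v.1 then max 0 (min 1 (realValue ν (v.2 ⟨i, h⟩))) else 0

theorem continuous_quotients (ν : ℕ ≃ ℚ) : Continuous (quotients ν) := by
  refine continuous_pi fun i => continuous_sigma fun z => ?_
  by_cases h : i < z
  · simp only [quotients, h, dite_true]
    exact continuous_const.max (continuous_const.min
      ((continuous_realValue ν).comp
        (continuous_apply (A := fun _ : Fin (z : ℕ) => Baire) ⟨i, h⟩)))
  · simpa only [quotients, h, dite_false] using continuous_const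

theorem quotients_spec {ν : ℕ ≃ ℚ} {d : (rDiv ν).dom → Baire} (hd : d ∈ (rDiv ν).choices)
    {p : (rDiv ν).dom} {a b : ℝ} (ha : IsRealName ν p.1.1 a) (hb : IsRealName ν p.1.2 b)
    (hab : 0 ≤ a ∧ a ≤ b) :
    max 0 (min 1 (realValue ν (d p))) ∈ Icc (0 : ℝ) 1 ∧
      max 0 (min 1 (realValue ν (d p))) * b = a := by
  refine ⟨⟨le_max_left _ _, max_le zero_le_one (min_le_left _ _)⟩, ?_⟩
  rcases (hab.1.trans hab.2).eq_or_lt with h | h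
  · rw [← h, mul_zero]
    linarith [hab.1, hab.2]
  · rw [(hd p a b ha hb h).realValue_eq, min_eq_right ((div_le_one h).2 hab.2),
      max_eq_right (div_nonneg hab.1 h.le), div_mul_cancel₀ _ h.ne']

theorem theorem32 (ν : ℕ ≃ ℚ) (hν : ν 0 = 0) :
    (Nash ν).Reduces (MultiFun.sup fun z : ℕ+ => (rDiv ν).power z) := by
  choose z num den O x y hnum hden hle hO hx hy hsol using exists_division_scheme ν
  obtain ⟨size, hsize, hsize_eq⟩ := exists_continuous_size ν
  choose un hun hunName using fun n m i =>
    hasClopenNhds_baire.exists_continuous_isRealName ν (hnum n m i)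
  choose ud hud hudName using fun n m i =>
    hasClopenNhds_baire.exists_continuous_isRealName ν (hden n m i)
  let G : (Nash ν).dom → (MultiFun.sup fun z : ℕ+ => (rDiv ν).power z).dom := fun w =>
    ⟨⟨z (size w).1 (size w).2,
      fun i => (un (size w).1 (size w).2 i w, ud (size w).1 (size w).2 i w)⟩,
      fun i => ⟨_, _, hunName _ _ _ _, hudName _ _ _ _, (hle _ _ _ _).1, (hle _ _ _ _).2⟩⟩
  have hG : Continuous G := by
    refine Continuous.subtype_mk ?_ _
    refine continuous_apply_of_discrete hsize (f := fun p (w : (Nash ν).dom) =>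
      (⟨z p.1 p.2, fun i => (un p.1 p.2 i w, ud p.1 p.2 i w)⟩ :
        Σ z : ℕ+, Fin (z : ℕ) → Baire × Baire)) fun p => continuous_sigmaMk.comp ?_
    exact continuous_pi fun i => ((hun _ _ _).comp continuous_subtype_val).prodMk
      ((hud _ _ _).comp continuous_subtype_val)
  let D : Set (Baire × Σ z : ℕ+, Fin (z : ℕ) → Baire) := {p | ∃ hw : p.1 ∈ (Nash ν).dom,
    ∃ g ∈ (MultiFun.sup fun z : ℕ+ => (rDiv ν).power z).choices, p.2 = g (G ⟨p.1, hw⟩)}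
  let S : D → ℕ × ℕ := fun d => size ⟨d.1.1, d.2.1⟩
  have hS : Continuous S :=
    hsize.comp (Continuous.subtype_mk (continuous_fst.comp continuous_subtype_val) _)
  let Q : D → ℕ → ℝ := fun d => quotients ν d.1.2
  have hQ : Continuous Q :=
    (continuous_quotients ν).comp (continuous_snd.comp continuous_subtype_val)
  have hquot : ∀ (d : D), ∀ i < (z (S d).1 (S d).2 : ℕ), Q d i ∈ Icc (0 : ℝ) 1 ∧
      Q d i * den (S d).1 (S d).2 d.1.1 i = num (S d).1 (S d).2 d.1.1 i := by
    rintro ⟨⟨w, v⟩, hw, g, ⟨f, hf, hgf⟩, hv⟩ i hi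
    obtain ⟨f', hf', hff'⟩ := hf (z (size ⟨w, hw⟩).1 (size ⟨w, hw⟩).2)
    have hv' : v = ⟨z (size ⟨w, hw⟩).1 (size ⟨w, hw⟩).2,
        fun i => f' i ⟨(G ⟨w, hw⟩).1.2 i, (G ⟨w, hw⟩).2 i⟩⟩ :=
      hv.trans ((hgf _).trans (congrArg (Sigma.mk _) (hff' _)))
    have hi' : i < (z (size ⟨w, hw⟩).1 (size ⟨w, hw⟩).2 : ℕ) := hi
    have hval : quotients ν v i = max 0 (min 1 (realValue ν
        (f' ⟨i, hi'⟩ ⟨(G ⟨w, hw⟩).1.2 ⟨i, hi'⟩, (G ⟨w, hw⟩).2 ⟨i, hi'⟩⟩))) := by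
      rw [hv']
      exact dif_pos hi'
    simp only [Q, hval]
    exact quotients_spec (hf' ⟨i, hi'⟩) (hunName _ _ _ _) (hudName _ _ _ _) (hle _ _ _ _)
  have hD : HasClopenNhds D := (hasClopenNhds_baire.prod (HasClopenNhds.sigma fun _ =>
    HasClopenNhds.pi fun _ => hasClopenNhds_baire)).of_isInducing IsInducing.subtypeVal
  -- The choice of one of the candidates.
  obtain ⟨σ, hσ, hσO⟩ := hD.exists_continuous_choice
    (O := fun k => {d : D | Q d ∈ O (S d).1 (S d).2 k}) (fun k => by
      rw [isOpen_iff_mem_nhds]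
      intro d hd
      filter_upwards [hQ.continuousAt.preimage_mem_nhds ((hO _ _ k).mem_nhds hd),
        hS.continuousAt.preimage_mem_nhds ((isOpen_discrete {S d}).mem_nhds rfl)] with d' h1 h2
      rw [show S d' = S d from h2]
      exact h1)
    fun d => by
      obtain ⟨n, m, A, B, h⟩ := d.2.1
      have hs : S d = (n, m) := hsize_eq ⟨d.1.1, d.2.1⟩ n m A B h
      have hq := hquot d
      simp only [hs] at hq
      simpa only [mem_ofPred_eq, hs] using (hsol n m d.1.1 A B h (Q d) hq).1
  have hSσ : Continuous fun d => (S d, σ d) := hS.prodMk hσ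
  choose ux hux huxName using fun i => hD.exists_continuous_isRealName ν
    (continuous_apply_of_discrete hSσ (f := fun (p : (ℕ × ℕ) × ℕ) (d : D) =>
      x p.1.1 p.1.2 p.2 (Q d) i) fun p => (hx _ _ _ _).comp hQ)
  choose uy huy huyName using fun j => hD.exists_continuous_isRealName ν
    (continuous_apply_of_discrete hSσ (f := fun (p : (ℕ × ℕ) × ℕ) (d : D) =>
      y p.1.1 p.1.2 p.2 (Q d) j) fun p => (hy _ _ _ _).comp hQ)
  refine ⟨G, D, fun d => strategyPairName (S d).1 (S d).2 (fun i => ux i d) fun j => uy j d, hG,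
    continuous_apply_of_discrete hS (f := fun p d =>
      strategyPairName p.1 p.2 (fun i => ux i d) fun j => uy j d)
      fun p => continuous_strategyPairName p.1 p.2 hux huy, fun g hg => ?_⟩
  refine ⟨fun w => ⟨w.2, g, hg, rfl⟩, fun w n m A B h => ?_⟩
  set d : D := ⟨((w : Baire), g (G w)), ⟨w.2, g, hg, rfl⟩⟩
  have hs : S d = (n, m) := hsize_eq w n m A B h
  have hq := hquot d
  have hk := hσO d
  have hux' := fun i => huxName i d
  have huy' := fun i => huyName i d
  simp only [mem_ofPred_eq, hs] at hq hk hux' huy'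
  refine ⟨_, _, (hsol n m w A B h (Q d) hq).2 (σ d) hk, ?_⟩
  change IsStrategyPairName ν
    (strategyPairName (S d).1 (S d).2 (fun i => ux i d) fun j => uy j d) _ _
  rw [hs]
  exact isStrategyPairName_strategyPairName (fun i => hux' i) fun j => huy' j

end Reduction
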